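/- **Theorem 5.1.** For a nonnegative integer $n$ let $[n]=\{1,\dots,n\}$ (with $[m]=\emptyset$ for $m\le 0$). For a partition $\pi$ of $[n]$ into nonempty blocks, an arc of $\pi$ is a pair $(i,j)$ with $i<j$ such that $i$ and $j$ lie in the same block of $\pi$ and no element of that block lies strictly between them. A partial matching of $[n]$ is a partition of $[n]$ all of whose blocks have at most two elements. Two arcs $(i_1,j_1)$ and $(i_2,j_2)$ of $\pi$ form - a left nesting if $i_1<i_2<j_2<j_1$ and $i_1+1=i_2$; - a right nesting if $i_1<i_2<j_2<j_1$ and $j_2+1=j_1$; - a left crossing if $i_1<i_2<j_1<j_2$ and $i_1+1=i_2$; - a neighbor alignment if $i_1<j_1<i_2<j_2$ and $j_1+1=i_2$. A transient of $\pi$ is an element of $[n]$ that is neither the minimum nor the maximum of its block. Let $\mathcal R(n,k)$ be the set of partial matchings of $[n]$ with exactly $k$ arcs and with no neighbor alignments, no left nestings and no right nestings, and let $\mathcal T(m,k)$ be the set of partitions of $[m]$ with exactly $k$ arcs and with no right nestings. Then for all nonnegative integers $n$ and $k$ there exists a bijection $\gamma:\mathcal R(n,k)\to\mathcal T(n-k+1,k)$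 such that for every $M\in\mathcal R(n,k)$ the number of transients of $\gamma(M)$ equals the number of left crossings of $M$ (the number of pairs of arcs of $M$ that form a left crossing). -/

import Mathlib

namespace NeighborPatterns

/-- A partition of `[n] = {1, …, n}` into nonempty blocks. -/
abbrev SetPartition (n : ℕ) : Type := Finpartition (Finset.Icc 1 n)

/-- The arcs `(i, j)` of the linear representation of `π`: the pairs `i < j` of consecutive elements
of a block of `π`. -/
def arcs {n : ℕ} (π : SetPartition n) : Finset (ℕ × ℕ) :=
  (Finset.Icc 1 n ×ˢ Finset.Icc 1 n).filter fun e =>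
    ∃ B ∈ π.parts, e.1 ∈ B ∧ e.2 ∈ B ∧ e.1 < e.2 ∧ ∀ l ∈ B, ¬ (e.1 < l ∧ l < e.2)

/-- A partial matching is a partition all of whose blocks have at most two elements. -/
def IsPartialMatching {n : ℕ} (π : SetPartition n) : Prop :=
  ∀ B ∈ π.parts, B.card ≤ 2

/-- `e = (i₁, j₁)` and `f = (i₂, j₂)` form a nesting: `i₁ < i₂ < j₂ < j₁`. -/
def Nesting (e f : ℕ × ℕ) : Prop :=
  e.1 < f.1 ∧ f.1 < f.2 ∧ f.2 < e.2

/-- `e = (i₁, j₁)` and `f = (i₂, j₂)` form a (2-)crossing: `i₁ < i₂ < j₁ < j₂`. -/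
def Crossing (e f : ℕ × ℕ) : Prop :=
  e.1 < f.1 ∧ f.1 < e.2 ∧ e.2 < f.2

/-- `e = (i₁, j₁)` and `f = (i₂, j₂)` form an alignment: `i₁ < j₁ < i₂ < j₂`. -/
def Alignment (e f : ℕ × ℕ) : Prop :=
  e.1 < e.2 ∧ e.2 < f.1 ∧ f.1 < f.2

/-- A nesting whose left-hand endpoints are adjacent. -/
def LeftNesting (e f : ℕ × ℕ) : Prop :=
  Nesting e f ∧ e.1 + 1 = f.1

/-- A nesting whose right-hand endpoints are adjacent. -/
def RightNesting (e f : ℕ × ℕ) : Prop :=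
  Nesting e f ∧ f.2 + 1 = e.2

/-- A crossing whose left-hand endpoints are adjacent. -/
def LeftCrossing (e f : ℕ × ℕ) : Prop :=
  Crossing e f ∧ e.1 + 1 = f.1

/-- An alignment in which the second arc starts immediately after the first one ends. -/
def NeighborAlignment (e f : ℕ × ℕ) : Prop :=
  Alignment e f ∧ e.2 + 1 = f.1

instance (e f : ℕ × ℕ) : Decidable (LeftCrossing e f) := by
  unfold LeftCrossing Crossing
  infer_instance

/-- No ordered pair of arcs of `π` forms the pattern `p`. -/
def Avoids {n : ℕ} (π : SetPartition n) (p : ℕ × ℕ → ℕ × ℕ → Prop) : Prop :=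
  ∀ e ∈ arcs π, ∀ f ∈ arcs π, ¬ p e f

/-- The number of left crossings of `π`, that is, of pairs of arcs that form a left crossing. -/
def leftCrossingCount {n : ℕ} (π : SetPartition n) : ℕ :=
  ((arcs π ×ˢ arcs π).filter fun p => LeftCrossing p.1 p.2).card

/-- The number of transients of `π`: elements that are neither the minimum nor the maximum of
their block, i.e. that lie strictly between two elements of their block. -/
def transientCount {n : ℕ} (π : SetPartition n) : ℕ :=
  ((Finset.Icc 1 n).filter fun x =>
    ∃ B ∈ π.parts, x ∈ B ∧ (∃ a ∈ B, a < x) ∧ (∃ b ∈ B, x < b)).card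

/-- `R(n, k)`: partial matchings of `[n]` with `k` arcs and with no neighbor alignments,
no left nestings and no right nestings. -/
def R (n k : ℕ) : Set (SetPartition n) :=
  {π | IsPartialMatching π ∧ (arcs π).card = k ∧
    Avoids π NeighborAlignment ∧ Avoids π LeftNesting ∧ Avoids π RightNesting}

/-- `T(m, k)`: partitions of `[m]` with `k` arcs and with no right nestings. -/
def T (m k : ℕ) : Set (SetPartition m) :=
  {π | (arcs π).card = k ∧ Avoids π RightNesting}

end NeighborPatterns

/-!
Both families are in bijection with upper triangular matrices of natural numbers of size
`S = n - 2k + 1` with sum of entries `k` (`Codes S k`), in such a way that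
each statistic is `k` minus the number of nonzero rows.

*Partial matchings.* A matching `M` in `R n k` has `S - 1` singleton blocks, which cut `[n]` into
`S` segments. Since a right endpoint is never followed by a left endpoint, each segment consists,
after the singleton block (if any) that opens it, of left endpoints followed by right endpoints.
The entry `(i, j)` of the matrix is the number of arcs from segment `i` to segment `j`.
Avoiding left and right nestings means that in a run of left
(right) endpoints the arcs are sorted by their other endpoints, so the matrix determines `M`.
Formally, every element gets a name in a lexicographic order, the names increase from left to
right (`strictMonoOn_nameOf`), and the set of names depends on the matrix only. Conversely, for
every matrix the increasing enumeration of its set of names defines a matching (`IsNaming.mem_R`).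
Any two arcs with adjacent left endpoints cross, so the left crossings are the left endpoints that
do not begin a run, and every nonzero row corresponds to one run (`card_rows_matchingCode`).

*Partitions without right nestings.* A partition of `[m]`, `m = S + k`, is a restricted growth
word: the letter at `p` is the index of the block of `p`, blocks being ordered by their minima.
The entry `(i, j)` of the matrix is the number of elements of block `i` that are not its minimum
and lie between the minima of blocks `j` and `j + 1`. There is no right nesting if and only if,
between two consecutive minima, the previous occurrences of the successive letters appear in
increasing order. Given what comes before, a multiset of letters has exactly one arrangement of
this kind: the letter with the earliest last occurrence has to come first (`run_unique`,
`run_exists`). Hence words and matrices correspond column by column (`code_bijOn`). The `k` left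
endpoints are the transients and the minima of the non-singleton blocks, and the latter correspond
to the nonzero rows (`card_rows_code`).
-/

namespace NeighborPatterns
open Finset

/-! ### Labellings and arcs -/

/-- `f` labels the partition `π` of `[n]`: two elements of `[n]` lie in the same block if and only
if `f` takes the same value at them. -/
def IsLabelling {n : ℕ} {α : Type*} (π : SetPartition n) (f : ℕ → α) : Prop :=
  ∀ p ∈ Icc 1 n, ∀ q ∈ Icc 1 n, f p = f q ↔ ∃ B ∈ π.parts, p ∈ B ∧ q ∈ B

lemma exists_partition_isLabelling {α : Type*} (n : ℕ) (f : ℕ → α) :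
    ∃ π : SetPartition n, IsLabelling π f := by
  classical
  let s : Setoid ℕ := Setoid.ker f
  have : DecidableRel s.r := fun a b => inferInstanceAs (Decidable (f a = f b))
  refine ⟨Finpartition.ofSetSetoid s (Icc 1 n), fun p hp q hq => ?_⟩
  have h := Finpartition.mem_part_ofSetSetoid_iff_rel (s := s) (a := q) (Icc 1 n) (b := p)
  rw [Finpartition.mem_part_iff_exists] at h
  rw [← and_assoc, and_iff_right ⟨hq, hp⟩] at h
  have h2 : s q p ↔ f p = f q := by
    change f q = f p ↔ _
    exact eq_comm
  rw [← h2, ← h]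

lemma exists_isLabelling {n : ℕ} (π : SetPartition n) :
    ∃ f : ℕ → Finset ℕ, IsLabelling π f := by
  refine ⟨π.part, fun p hp q hq => ?_⟩
  rw [← Finpartition.mem_part_iff_exists]
  exact (π.mem_part_iff_part_eq_part hp hq).symm

lemma IsLabelling.mem_of_eq {n : ℕ} {α : Type*} {π : SetPartition n} {f : ℕ → α}
    (h : IsLabelling π f) {B : Finset ℕ} (hB : B ∈ π.parts) {p q : ℕ} (hp : p ∈ B)
    (hq : q ∈ Icc 1 n) (e : f p = f q) : q ∈ B := by
  obtain ⟨B', hB', hp', hq'⟩ := (h p (π.le hB hp) q hq).1 e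
  rwa [(π.existsUnique_mem (π.le hB hp)).unique ⟨hB, hp⟩ ⟨hB', hp'⟩]

lemma IsLabelling.eq_of_mem {n : ℕ} {α : Type*} {π : SetPartition n} {f : ℕ → α}
    (h : IsLabelling π f) {B : Finset ℕ} (hB : B ∈ π.parts) {p q : ℕ} (hp : p ∈ B)
    (hq : q ∈ B) : f p = f q :=
  (h p (π.le hB hp) q (π.le hB hq)).2 ⟨B, hB, hp, hq⟩

lemma IsLabelling.parts_subset {n : ℕ} {α β : Type*} {π π' : SetPartition n} {f : ℕ → α}
    {f' : ℕ → β} (h : IsLabelling π f) (h' : IsLabelling π' f')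
    (hff : ∀ p ∈ Icc 1 n, ∀ q ∈ Icc 1 n, f p = f q ↔ f' p = f' q) : π.parts ⊆ π'.parts := by
  intro B hB
  obtain ⟨p, hp⟩ := π.nonempty_of_mem_parts hB
  obtain ⟨B', hB', hp'⟩ := π'.exists_mem (π.le hB hp)
  have : B = B' := by
    ext q
    constructor
    · intro hq
      exact h'.mem_of_eq hB' hp' (π.le hB hq)
        ((hff _ (π.le hB hp) _ (π.le hB hq)).1 (h.eq_of_mem hB hp hq))
    · intro hq
      exact h.mem_of_eq hB hp (π'.le hB' hq)
        ((hff _ (π.le hB hp) _ (π'.le hB' hq)).2 (h'.eq_of_mem hB' hp' hq))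
  rwa [this]

/-- A partition is determined by any of its labellings. -/
lemma IsLabelling.unique {n : ℕ} {α β : Type*} {π π' : SetPartition n} {f : ℕ → α} {f' : ℕ → β}
    (h : IsLabelling π f) (h' : IsLabelling π' f')
    (hff : ∀ p ∈ Icc 1 n, ∀ q ∈ Icc 1 n, f p = f q ↔ f' p = f' q) : π = π' :=
  Finpartition.ext (Subset.antisymm (h.parts_subset h' hff)
    (h'.parts_subset h fun p hp q hq => (hff p hp q hq).symm))

lemma IsLabelling.congr {n : ℕ} {α β : Type*} {π : SetPartition n} {f : ℕ → α} {f' : ℕ → β}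
    (h : IsLabelling π f)
    (hff : ∀ p ∈ Icc 1 n, ∀ q ∈ Icc 1 n, f' p = f' q ↔ f p = f q) : IsLabelling π f' :=
  fun p hp q hq => (hff p hp q hq).trans (h p hp q hq)

lemma IsLabelling.mem_arcs {n : ℕ} {α : Type*} {π : SetPartition n} {f : ℕ → α}
    (h : IsLabelling π f) {i j : ℕ} :
    (i, j) ∈ arcs π ↔ 1 ≤ i ∧ j ≤ n ∧ i < j ∧ f i = f j ∧ ∀ l, i < l → l < j → f l ≠ f i := by
  simp only [arcs, mem_filter, mem_product, mem_Icc]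
  constructor
  · rintro ⟨⟨⟨hi, hi'⟩, hj, hj'⟩, B, hB, hiB, hjB, hij, hl⟩
    refine ⟨hi, hj', hij, h.eq_of_mem hB hiB hjB, fun l hl1 hl2 e => ?_⟩
    exact hl l (h.mem_of_eq hB hiB (mem_Icc.2 ⟨by lia, by lia⟩) e.symm) ⟨hl1, hl2⟩
  · rintro ⟨hi, hj, hij, e, hl⟩
    obtain ⟨B, hB, hiB, hjB⟩ :=
      (h i (mem_Icc.2 ⟨by lia, by lia⟩) j (mem_Icc.2 ⟨by lia, by lia⟩)).1 e
    refine ⟨by lia, B, hB, hiB, hjB, hij, fun l hlB hlt => ?_⟩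
    exact hl l hlt.1 hlt.2 (h.eq_of_mem hB hlB hiB)

lemma arc_bounds {n : ℕ} {π : SetPartition n} {i j : ℕ} (h : (i, j) ∈ arcs π) :
    1 ≤ i ∧ i < j ∧ j ≤ n := by
  obtain ⟨f, hf⟩ := exists_isLabelling π
  have := hf.mem_arcs.1 h
  exact ⟨this.1, this.2.2.1, this.2.1⟩

lemma arc_right_unique {n : ℕ} {π : SetPartition n} {i j j' : ℕ} (h : (i, j) ∈ arcs π)
    (h' : (i, j') ∈ arcs π) : j = j' := by
  obtain ⟨f, hf⟩ := exists_isLabelling π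
  obtain ⟨-, -, h1, h2, h3⟩ := hf.mem_arcs.1 h
  obtain ⟨-, -, h1', h2', h3'⟩ := hf.mem_arcs.1 h'
  rcases lt_trichotomy j j' with hl | hl | hl
  · exact absurd h2.symm (h3' j h1 hl)
  · exact hl
  · exact absurd h2'.symm (h3 j' h1' hl)

lemma arc_left_unique {n : ℕ} {π : SetPartition n} {i i' j : ℕ} (h : (i, j) ∈ arcs π)
    (h' : (i', j) ∈ arcs π) : i = i' := by
  obtain ⟨f, hf⟩ := exists_isLabelling π
  obtain ⟨-, -, h1, h2, h3⟩ := hf.mem_arcs.1 h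
  obtain ⟨-, -, h1', h2', h3'⟩ := hf.mem_arcs.1 h'
  rcases lt_trichotomy i i' with hl | hl | hl
  · exact absurd (h2'.trans h2.symm) (h3 i' hl h1')
  · exact hl
  · exact absurd (h2.trans h2'.symm) (h3' i hl h1)

lemma IsLabelling.exists_arc_left {n : ℕ} {α : Type*} {π : SetPartition n} {f : ℕ → α}
    (h : IsLabelling π f) {p q : ℕ} (hp : 1 ≤ p) (hpq : p < q) (hq : q ≤ n) (e : f p = f q) :
    ∃ r, (r, q) ∈ arcs π := by
  classical
  have hne : ((Ico 1 q).filter fun r => f r = f q).Nonempty :=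
    ⟨p, by simp [hp, hpq, e]⟩
  obtain ⟨hm, hm2⟩ := mem_filter.1 (max'_mem _ hne)
  refine ⟨_, h.mem_arcs.2 ⟨(mem_Ico.1 hm).1, hq, (mem_Ico.1 hm).2, hm2, fun l hl1 hl2 e' => ?_⟩⟩
  refine absurd (le_max' ((Ico 1 q).filter fun r => f r = f q) l ?_) (not_le.2 hl1)
  rw [mem_filter, mem_Ico]
  exact ⟨⟨by have := (mem_Ico.1 hm).1; lia, hl2⟩, e'.trans hm2⟩

lemma IsLabelling.exists_arc_right {n : ℕ} {α : Type*} {π : SetPartition n} {f : ℕ → α}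
    (h : IsLabelling π f) {p q : ℕ} (hp : 1 ≤ p) (hpq : p < q) (hq : q ≤ n) (e : f p = f q) :
    ∃ r, (p, r) ∈ arcs π := by
  classical
  have hne : ((Ioc p n).filter fun r => f r = f p).Nonempty :=
    ⟨q, by simp [hq, hpq, e]⟩
  obtain ⟨hm, hm2⟩ := mem_filter.1 (min'_mem _ hne)
  refine ⟨_, h.mem_arcs.2 ⟨hp, (mem_Ioc.1 hm).2, (mem_Ioc.1 hm).1, hm2.symm,
    fun l hl1 hl2 e' => ?_⟩⟩
  refine absurd (min'_le ((Ioc p n).filter fun r => f r = f p) l ?_) (not_le.2 hl2)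
  rw [mem_filter, mem_Ioc]
  exact ⟨⟨hl1, by have := (mem_Ioc.1 hm).2; lia⟩, e'⟩

/-! ### Codes -/

/-- A code with `S` columns and weight `k`: the multiplicity of `i` in `C j` is the entry in row `i`
and column `j` of an upper triangular `S × S` matrix of natural numbers with sum `k`. -/
def Codes (S k : ℕ) : Set (ℕ → Multiset ℕ) :=
  {C | (∀ j, ∀ i ∈ C j, i ≤ j) ∧ (∀ j, S ≤ j → C j = 0) ∧ ∑ j ∈ range S, (C j).card = k}

/-- The nonzero rows of the matrix encoded by `C`. -/
def rows (S : ℕ) (C : ℕ → Multiset ℕ) : Finset ℕ :=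
  (range S).biUnion fun j => (C j).toFinset

lemma mem_rows {S : ℕ} {C : ℕ → Multiset ℕ} {i : ℕ} : i ∈ rows S C ↔ ∃ j < S, i ∈ C j := by
  simp [rows]

/-! ### Words and codes -/

/-- The number of distinct labels of a restricted growth word. Words are stored with the most recent
letter first, and a letter is new when it equals the number of labels used before. -/
def numLabels : List ℕ → ℕ
  | [] => 0
  | a :: h => if a = numLabels h then numLabels h + 1 else numLabels h

/-- Restricted growth words, most recent letter first: each letter is an earlier label or the
smallest unused natural number. -/
def IsRG : List ℕ → Prop
  | [] => True
  | a :: h => IsRG h ∧ a ≤ numLabels h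

/-- The letter `a` may follow the word `g` without creating a right nesting: if `a` and the last
letter `b` of `g` both repeat earlier letters, the previous occurrence of `b` precedes that of
`a`. -/
def Step (g : List ℕ) (a : ℕ) : Prop :=
  ∀ b h, g = b :: h → a < numLabels g → b < numLabels h → a = b ∨ h.idxOf a < h.idxOf b

/-- Words, most recent letter first, that encode partitions without right nestings. -/
def IsLegal : List ℕ → Prop
  | [] => True
  | a :: h => IsLegal h ∧ Step h a

/-- The code of a word: `code l j` collects the repeated letters between the first occurrences of
`j` and of `j + 1`. -/
def code : List ℕ → ℕ → Multiset ℕ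
  | [] => 0
  | a :: h => if a = numLabels h then code h else
      Function.update (code h) (numLabels h - 1) (a ::ₘ code h (numLabels h - 1))

/-- `Run g r` says that the letters of `r`, oldest first, can be appended one by one to the
word `g` so that each one has the earliest last occurrence among the letters still to come. -/
def Run : List ℕ → List ℕ → Prop
  | _, [] => True
  | g, b :: r => (∀ c ∈ r, c = b ∨ g.idxOf c < g.idxOf b) ∧ Run (b :: g) r

/-- `Rep C j l` says that `l` is built column by column from `C 0, …, C (j - 1)`: the new letter `i`
is followed by the letters of `C i`, arranged as a run. -/
def Rep (C : ℕ → Multiset ℕ) : ℕ → List ℕ → Prop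
  | 0, l => l = []
  | j + 1, l => ∃ g r : List ℕ, Rep C j g ∧ (r : Multiset ℕ) = C j ∧ Run (j :: g) r ∧
      l = List.reverseAux r (j :: g)

lemma IsRG.mem_iff {l : List ℕ} (h : IsRG l) {a : ℕ} : a ∈ l ↔ a < numLabels l := by
  induction l with
  | nil => simp [numLabels]
  | cons b l ih =>
    obtain ⟨h1, h2⟩ := h
    rw [List.mem_cons, ih h1, numLabels]
    split_ifs <;> lia

/-- Each multiset of letters has at most one arrangement as a run after `g`: all arrangements start
with the letter whose last occurrence in `g` is earliest. -/
lemma run_unique {g r r' : List ℕ} (h : Run g r) (h' : Run g r') (hp : r.Perm r') : r = r' := by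
  induction r generalizing g r' with
  | nil => simpa using hp.symm.eq_nil
  | cons b r ih =>
    cases r' with
    | nil => simpa using hp.eq_nil
    | cons b' r' =>
      have hb : b = b' := by
        by_contra hne
        have h1 : b ∈ r' := by
          have := hp.subset (List.mem_cons_self (a := b) (l := r))
          simpa [hne] using this
        have h2 : b' ∈ r := by
          have := hp.symm.subset (List.mem_cons_self (a := b') (l := r'))
          simpa [Ne.symm hne] using this
        have h3 := h'.1 b h1
        have h4 := h.1 b' h2
        lia
      subst hb
      rw [ih h.2 h'.2 ((List.perm_cons b).1 hp)]

lemma run_exists (x : Multiset ℕ) : ∀ g : List ℕ, (∀ a ∈ x, a ∈ g) →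
    ∃ r : List ℕ, (r : Multiset ℕ) = x ∧ Run g r := by
  induction hn : x.card generalizing x with
  | zero =>
    intro g _
    exact ⟨[], by simpa using (Multiset.card_eq_zero.1 hn).symm, trivial⟩
  | succ n ih =>
    intro g hx
    have hne : x.toFinset.Nonempty := by
      rw [Multiset.toFinset_nonempty]
      rintro rfl
      simp at hn
    obtain ⟨b, hb, hmax⟩ := exists_max_image x.toFinset g.idxOf hne
    rw [Multiset.mem_toFinset] at hb
    obtain ⟨y, rfl⟩ := Multiset.exists_cons_of_mem hb
    obtain ⟨r, hr, hrun⟩ := ih y (by simpa using hn) (b :: g)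
      (fun a ha => List.mem_cons_of_mem _ (hx a (Multiset.mem_cons_of_mem ha)))
    refine ⟨b :: r, by rw [← hr]; rfl, fun c hc => ?_, hrun⟩
    have hcy : c ∈ b ::ₘ y := by
      rw [← hr]
      exact Multiset.mem_cons_of_mem hc
    have hle := hmax c (Multiset.mem_toFinset.2 hcy)
    rcases hle.lt_or_eq with h | h
    · exact Or.inr h
    · exact Or.inl ((List.idxOf_inj (hx c hcy)).1 h)

/-- The condition defining a run only has to be checked for consecutive letters, because an
occurrence of a letter outdates its earlier occurrences. -/
lemma run_concat {g r : List ℕ} {a b : ℕ} (h : Run g (r ++ [b]))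
    (hab : a = b ∨ (List.reverseAux r g).idxOf a < (List.reverseAux r g).idxOf b) :
    Run g (r ++ [b] ++ [a]) := by
  induction r generalizing g with
  | nil => simpa [Run] using hab
  | cons c r ih =>
    obtain ⟨h1, h2⟩ := h
    have h3 := ih h2 hab
    refine ⟨fun d hd => ?_, h3⟩
    rcases List.mem_append.1 hd with hd | hd
    · exact h1 d hd
    · obtain rfl : d = a := by simpa using hd
      have key : ∀ e ∈ r ++ [b], d = e ∨ (c :: g).idxOf d < (c :: g).idxOf e →
          d = c ∨ g.idxOf d < g.idxOf c := by
        intro e he hde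
        rcases hde with rfl | hde
        · exact h1 _ he
        · rw [List.idxOf_cons, List.idxOf_cons] at hde
          have := h1 e he
          grind
      cases r with
      | nil => exact key b (by simp) hab
      | cons e r => exact key e (by simp) (h3.1 d (by simp))

lemma isRG_reverseAux {g r : List ℕ} (hg : IsRG g) (hr : ∀ b ∈ r, b < numLabels g) :
    IsRG (List.reverseAux r g) ∧ numLabels (List.reverseAux r g) = numLabels g ∧
      (List.reverseAux r g).length = g.length + r.length ∧
      code (List.reverseAux r g) = Function.update (code g) (numLabels g - 1)
        ((r : Multiset ℕ) + code g (numLabels g - 1)) := by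
  induction r generalizing g with
  | nil => simp [hg]
  | cons b r ih =>
    have hb := hr b (by simp)
    have hN : numLabels (b :: g) = numLabels g := by
      rw [numLabels, if_neg hb.ne]
    obtain ⟨h1, h2, h3, h4⟩ := ih (g := b :: g) ⟨hg, hb.le⟩ (by
      rw [hN]; exact fun c hc => hr c (by simp [hc]))
    rw [List.reverseAux]
    refine ⟨h1, h2.trans hN, by rw [h3]; simp; lia, ?_⟩
    rw [h4, hN, code, if_neg hb.ne]
    simp only [Function.update_self, Function.update_idem]
    congr 1
    rw [← Multiset.cons_coe, Multiset.cons_add, Multiset.add_cons]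

lemma isLegal_reverseAux {g r : List ℕ} (hg : IsLegal g) (hr : ∀ a ∈ r, Step g a) (h : Run g r) :
    IsLegal (List.reverseAux r g) := by
  induction r generalizing g with
  | nil => exact hg
  | cons b r ih =>
    rw [List.reverseAux]
    refine ih ⟨hg, hr b (by simp)⟩ (fun a ha c k hck _ _ => ?_) h.2
    obtain ⟨rfl, rfl⟩ := List.cons.inj hck
    exact h.1 a ha

lemma step_of_new {g : List ℕ} {a : ℕ} : Step (numLabels g :: g) a := by
  intro b h hbh _ hb
  obtain ⟨rfl, rfl⟩ := List.cons.inj hbh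
  exact absurd hb (lt_irrefl _)

lemma step_new {g : List ℕ} : Step g (numLabels g) :=
  fun _ _ _ h _ => absurd h (lt_irrefl _)

lemma Rep.spec {C : ℕ → Multiset ℕ} (hC : ∀ j, ∀ i ∈ C j, i ≤ j) {j : ℕ} {l : List ℕ}
    (h : Rep C j l) : IsRG l ∧ IsLegal l ∧ numLabels l = j ∧
      l.length = j + ∑ i ∈ range j, (C i).card ∧
      (∀ i < j, code l i = C i) ∧ ∀ i, j ≤ i → code l i = 0 := by
  induction j generalizing l with
  | zero =>
    obtain rfl : l = [] := h
    simp [IsRG, IsLegal, numLabels, code]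
  | succ j ih =>
    obtain ⟨g, r, hg, hr, hrun, rfl⟩ := h
    obtain ⟨h1, h2, h3, h4, h5, h6⟩ := ih hg
    have hN : numLabels (j :: g) = j + 1 := by rw [numLabels, if_pos h3.symm, h3]
    have hcode : code (j :: g) = code g := by rw [code, if_pos h3.symm]
    obtain ⟨k1, k2, k3, k4⟩ := isRG_reverseAux (g := j :: g) (r := r) ⟨h1, h3.ge⟩ (by
      intro b hb
      have := hC j b (by rw [← hr]; exact hb)
      lia)
    have hlen : r.length = (C j).card := by rw [← hr]; rfl
    refine ⟨k1, ?_, k2.trans hN, ?_, ?_, ?_⟩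
    · subst h3
      exact isLegal_reverseAux ⟨h2, step_new⟩ (fun a _ => step_of_new) hrun
    · rw [k3, sum_range_succ, List.length_cons, h4, hlen]
      lia
    · intro i hi
      rw [k4, hN, hcode, Nat.add_sub_cancel]
      rcases eq_or_ne i j with rfl | hij
      · rw [Function.update_self, h6 _ le_rfl, hr, add_zero]
      · rw [Function.update_of_ne hij]
        exact h5 i (by lia)
    · intro i hi
      rw [k4, hN, hcode, Nat.add_sub_cancel, Function.update_of_ne (by lia)]
      exact h6 i (by lia)

lemma Rep.congr {C C' : ℕ → Multiset ℕ} {j : ℕ} {l : List ℕ} (h : Rep C j l)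
    (hC : ∀ i < j, C i = C' i) : Rep C' j l := by
  induction j generalizing l with
  | zero => exact h
  | succ j ih =>
    obtain ⟨g, r, hg, hr, hrun, hl⟩ := h
    exact ⟨g, r, ih hg fun i hi => hC i (by lia), hr.trans (hC j (by lia)), hrun, hl⟩

lemma Rep.unique {C : ℕ → Multiset ℕ} {j : ℕ} {l l' : List ℕ} (h : Rep C j l)
    (h' : Rep C j l') : l = l' := by
  induction j generalizing l l' with
  | zero => exact Eq.trans h (Eq.symm h')
  | succ j ih =>
    obtain ⟨g, r, hg, hr, hrun, rfl⟩ := h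
    obtain ⟨g', r', hg', hr', hrun', rfl⟩ := h'
    obtain rfl := ih hg hg'
    rw [run_unique hrun hrun' (Multiset.coe_eq_coe.1 (hr.trans hr'.symm))]

lemma Rep.exists {C : ℕ → Multiset ℕ} (hC : ∀ j, ∀ i ∈ C j, i ≤ j) (j : ℕ) :
    ∃ l, Rep C j l := by
  induction j with
  | zero => exact ⟨[], rfl⟩
  | succ j ih =>
    obtain ⟨g, hg⟩ := ih
    obtain ⟨h1, -, h3, -⟩ := hg.spec hC
    have hN : numLabels (j :: g) = j + 1 := by rw [numLabels, if_pos h3.symm, h3]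
    have hRG : IsRG (j :: g) := ⟨h1, h3.ge⟩
    obtain ⟨r, hr, hrun⟩ := run_exists (C j) (j :: g) fun a ha => by
      rw [hRG.mem_iff, hN]
      have := hC j a ha
      lia
    exact ⟨_, g, r, hg, hr, hrun, rfl⟩

lemma code_mem_le {l : List ℕ} (h : IsRG l) :
    (∀ j, ∀ i ∈ code l j, i ≤ j) ∧ ∀ j, numLabels l ≤ j → code l j = 0 := by
  induction l with
  | nil => simp [code]
  | cons a l ih =>
    obtain ⟨h1, h2⟩ := ih h.1
    have ha := h.2
    rw [code, numLabels]
    split_ifs with hN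
    · exact ⟨h1, fun j hj => h2 j (by lia)⟩
    · constructor
      · intro j i hi
        rw [Function.update_apply] at hi
        split_ifs at hi with hj
        · rw [Multiset.mem_cons] at hi
          rcases hi with rfl | hi
          · lia
          · exact hj ▸ h1 _ i hi
        · exact h1 j i hi
      · intro j hj
        rw [Function.update_of_ne (by lia)]
        exact h2 j hj

/-- Every legal restricted growth word is built column by column from its code. -/
lemma rep_code {l : List ℕ} (h : IsRG l) (h' : IsLegal l) : Rep (code l) (numLabels l) l := by
  induction l with
  | nil => rfl
  | cons a h0 ih =>
    have ih := ih h.1 h'.1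
    have ha := h.2
    rw [code, numLabels]
    split_ifs with hN
    · refine ⟨h0, [], ih, ?_, trivial, by rw [hN]; rfl⟩
      exact ((code_mem_le h.1).2 _ le_rfl).symm
    · obtain ⟨j, hj⟩ : ∃ j, numLabels h0 = j + 1 := ⟨numLabels h0 - 1, by lia⟩
      rw [hj] at ih ⊢
      obtain ⟨g, r, hg, hr, hrun, hl⟩ := ih
      rw [Nat.add_sub_cancel]
      refine ⟨g, r ++ [a], hg.congr fun i hi => ?_, ?_, ?_, ?_⟩
      · rw [Function.update_of_ne hi.ne]
      · rw [Function.update_self, ← hr, Multiset.cons_coe, Multiset.coe_eq_coe]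
        exact List.perm_append_singleton a r
      · rcases List.eq_nil_or_concat' r with rfl | ⟨r0, b, rfl⟩
        · exact ⟨by simp, trivial⟩
        · refine run_concat hrun ?_
          have hl' : h0 = b :: List.reverseAux r0 (j :: g) := by
            rw [hl]; simp [List.reverseAux_eq]
          have hRG := h.1
          have hNl := hj
          rw [hl'] at hRG hNl
          have hbj : b ≤ j := by
            have := (code_mem_le h.1).1 j b (by rw [← hr]; simp)
            exact this
          have hmem : b ∈ List.reverseAux r0 (j :: g) := by
            have hg' := hg.spec (code_mem_le h.1).1
            rw [List.reverseAux_eq, List.mem_append, List.mem_cons, hg'.1.mem_iff, hg'.2.2.1]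
            lia
          exact h'.2 b _ hl' (by lia) (hRG.1.mem_iff.1 hmem)
      · rw [hl]; simp [List.reverseAux_eq]

/-- Legal restricted growth words with `S` distinct letters and `k` repetitions. -/
def Words (S k : ℕ) : Set (List ℕ) :=
  {l | IsRG l ∧ IsLegal l ∧ numLabels l = S ∧ l.length = S + k}

lemma code_bijOn (S k : ℕ) : Set.BijOn code (Words S k) (Codes S k) := by
  refine ⟨?_, ?_, ?_⟩
  · rintro l ⟨h1, h2, h3, h4⟩
    have hC := code_mem_le h1
    have hs := (rep_code h1 h2).spec hC.1
    subst h3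
    exact ⟨hC.1, hC.2, by have := hs.2.2.2.1; lia⟩
  · rintro l ⟨h1, h2, h3, -⟩ l' ⟨h1', h2', h3', -⟩ e
    have h := rep_code h1 h2
    have h' := rep_code h1' h2'
    rw [h3] at h
    rw [h3', ← e] at h'
    exact h.unique h'
  · rintro C ⟨hC, hC0, hk⟩
    obtain ⟨l, hl⟩ := Rep.exists hC S
    obtain ⟨h1, h2, h3, h4, h5, h6⟩ := hl.spec hC
    refine ⟨l, ⟨h1, h2, h3, h4.trans (by rw [hk])⟩, funext fun j => ?_⟩
    rcases lt_or_ge j S with hj | hj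
    · exact h5 j hj
    · rw [h6 j hj, hC0 j hj]

/-! ### Words and partitions without right nestings -/

/-- The letter in position `p` of a word, positions being numbered from `1` in reading order. -/
def letter : List ℕ → ℕ → ℕ
  | [], _ => 0
  | a :: h, p => if p = h.length + 1 then a else letter h p

lemma letter_last (a : ℕ) (h : List ℕ) : letter (a :: h) (h.length + 1) = a := by
  simp [letter]

lemma letter_of_le (a : ℕ) {h : List ℕ} {p : ℕ} (hp : p ≤ h.length) :
    letter (a :: h) p = letter h p := by
  rw [letter, if_neg (by lia)]

lemma mem_iff_letter {l : List ℕ} {a : ℕ} : a ∈ l ↔ ∃ p, 1 ≤ p ∧ p ≤ l.length ∧ letter l p = a := by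
  induction l with
  | nil => simp
  | cons b h ih =>
    rw [List.mem_cons, ih]
    constructor
    · rintro (rfl | ⟨p, hp, hp', rfl⟩)
      · exact ⟨h.length + 1, by lia, by simp, letter_last _ _⟩
      · exact ⟨p, hp, by simp; lia, letter_of_le _ hp'⟩
    · rintro ⟨p, hp, hp', rfl⟩
      rcases eq_or_ne p (h.length + 1) with rfl | hne
      · exact Or.inl (letter_last _ _)
      · rw [List.length_cons] at hp'
        exact Or.inr ⟨p, hp, by lia, (letter_of_le _ (by lia)).symm⟩

/-- A restricted growth word is determined by its length and the partition of its positions. -/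
lemma IsRG.ext {l l' : List ℕ} (h : IsRG l) (h' : IsRG l') (hlen : l.length = l'.length)
    (hll : ∀ p ∈ Icc 1 l.length, ∀ q ∈ Icc 1 l.length,
      letter l p = letter l q ↔ letter l' p = letter l' q) : l = l' := by
  induction l generalizing l' with
  | nil => exact (List.length_eq_zero_iff.1 hlen.symm).symm
  | cons a g ih =>
    cases l' with
    | nil => simp at hlen
    | cons a' g' =>
      have hlen' : g.length = g'.length := by simpa using hlen
      obtain rfl : g = g' := by
        refine ih h.1 h'.1 hlen' fun p hp q hq => ?_
        rw [mem_Icc] at hp hq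
        have := hll p (mem_Icc.2 ⟨hp.1, by simp; lia⟩) q (mem_Icc.2 ⟨hq.1, by simp; lia⟩)
        rwa [letter_of_le _ hp.2, letter_of_le _ hq.2, letter_of_le _ (by lia),
          letter_of_le _ (by lia)] at this
      have key : ∀ p, 1 ≤ p → p ≤ g.length → (letter g p = a ↔ letter g p = a') := by
        intro p hp hp'
        have := hll p (mem_Icc.2 ⟨hp, by simp; lia⟩) (g.length + 1) (mem_Icc.2 ⟨by lia, by simp⟩)
        rwa [letter_of_le _ hp', letter_of_le _ hp', letter_last, letter_last] at this
      have hmem : ∀ b, b ∈ g → (b = a ↔ b = a') := by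
        intro b hb
        obtain ⟨p, hp, hp', rfl⟩ := mem_iff_letter.1 hb
        exact key p hp hp'
      have h1 := h.2
      have h2 := h'.2
      have h3 := h.1.mem_iff (a := a)
      have h4 := h.1.mem_iff (a := a')
      have h5 := hmem a
      have h6 := hmem a'
      have : a = a' := by grind
      rw [this]

lemma exists_isRG {α : Type*} (f : ℕ → α) (m : ℕ) : ∃ l, l.length = m ∧ IsRG l ∧
    ∀ p ∈ Icc 1 m, ∀ q ∈ Icc 1 m, letter l p = letter l q ↔ f p = f q := by
  classical
  induction m with
  | zero => exact ⟨[], rfl, trivial, by simp⟩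
  | succ m ih =>
    obtain ⟨l, rfl, hl, hll⟩ := ih
    obtain ⟨a, ha, haf⟩ : ∃ a, a ≤ numLabels l ∧
        ∀ p ∈ Icc 1 l.length, letter l p = a ↔ f p = f (l.length + 1) := by
      by_cases hex : ∃ q ∈ Icc 1 l.length, f q = f (l.length + 1)
      · obtain ⟨q, hq, hqf⟩ := hex
        refine ⟨letter l q, (hl.mem_iff.1 (mem_iff_letter.2
          ⟨q, (mem_Icc.1 hq).1, (mem_Icc.1 hq).2, rfl⟩)).le, fun p hp => ?_⟩
        rw [hll p hp q hq, hqf]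
      · refine ⟨numLabels l, le_rfl, fun p hp => iff_of_false (fun e => ?_) fun e => hex ⟨p, hp, e⟩⟩
        have := hl.mem_iff.1 (mem_iff_letter.2 ⟨p, (mem_Icc.1 hp).1, (mem_Icc.1 hp).2, rfl⟩)
        lia
    refine ⟨a :: l, rfl, ⟨hl, ha⟩, fun p hp q hq => ?_⟩
    rw [mem_Icc] at hp hq
    rcases eq_or_ne p (l.length + 1) with rfl | hp'
    · rcases eq_or_ne q (l.length + 1) with rfl | hq'
      · simp
      · rw [letter_last, letter_of_le _ (by lia), eq_comm, haf q (mem_Icc.2 (by lia)), eq_comm]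
    · rcases eq_or_ne q (l.length + 1) with rfl | hq'
      · rw [letter_last, letter_of_le _ (by lia), haf p (mem_Icc.2 (by lia))]
      · rw [letter_of_le _ (by lia), letter_of_le _ (by lia),
          hll p (mem_Icc.2 (by lia)) q (mem_Icc.2 (by lia))]

/-- `(i, j)` is an arc of the partition of the positive integers into the fibres of `f`. -/
def IsArc {α : Type*} (f : ℕ → α) (i j : ℕ) : Prop :=
  1 ≤ i ∧ i < j ∧ f i = f j ∧ ∀ l, i < l → l < j → f l ≠ f i

lemma IsLabelling.mem_arcs_iff {n : ℕ} {α : Type*} {π : SetPartition n} {f : ℕ → α}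
    (h : IsLabelling π f) {i j : ℕ} : (i, j) ∈ arcs π ↔ j ≤ n ∧ IsArc f i j := by
  rw [h.mem_arcs, IsArc]
  tauto

lemma isArc_letter_cons {a : ℕ} {h : List ℕ} {i j : ℕ} (hj : j ≤ h.length) :
    IsArc (letter (a :: h)) i j ↔ IsArc (letter h) i j := by
  unfold IsArc
  refine and_congr_right fun h1 => and_congr_right fun h2 => ?_
  rw [letter_of_le _ (by lia), letter_of_le _ hj]
  refine and_congr_right fun _ => forall_congr' fun l => forall_congr' fun h3 =>
    forall_congr' fun h4 => ?_
  rw [letter_of_le _ (by lia)]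

lemma letter_lastPos {g : List ℕ} {b : ℕ} (hb : b ∈ g) :
    letter g (g.length - g.idxOf b) = b ∧
      ∀ q, g.length - g.idxOf b < q → q ≤ g.length → letter g q ≠ b := by
  induction g with
  | nil => simp at hb
  | cons a g ih =>
    rw [List.idxOf_cons]
    by_cases hab : a = b
    · subst hab
      simp [letter_last]
      lia
    · have hb' : b ∈ g := by simpa [Ne.symm hab] using hb
      obtain ⟨h1, h2⟩ := ih hb'
      have hlt := List.idxOf_lt_length_of_mem hb'
      have hba : (a == b) = false := by simpa using hab
      simp only [hba, List.length_cons, cond_false, Nat.add_sub_add_right]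
      rw [letter_of_le _ (by lia)]
      refine ⟨h1, fun q hq hq' => ?_⟩
      rcases eq_or_ne q (g.length + 1) with rfl | hne
      · rwa [letter_last]
      · rw [letter_of_le _ (by lia)]
        exact h2 q hq (by lia)

/-- The arc that ends at the last position of `a :: h` starts at the last occurrence of `a` in
`h`. -/
lemma isArc_letter_last {a : ℕ} {h : List ℕ} {i : ℕ} :
    IsArc (letter (a :: h)) i (h.length + 1) ↔ a ∈ h ∧ i = h.length - h.idxOf a := by
  constructor
  · rintro ⟨h1, h2, h3, h4⟩
    rw [letter_last, letter_of_le _ (by lia)] at h3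
    have ha : a ∈ h := mem_iff_letter.2 ⟨i, h1, by lia, h3⟩
    have hlt := List.idxOf_lt_length_of_mem ha
    obtain ⟨k1, k2⟩ := letter_lastPos ha
    refine ⟨ha, ?_⟩
    rcases lt_trichotomy i (h.length - h.idxOf a) with hl | hl | hl
    · refine absurd ?_ (h4 _ hl (by lia))
      rw [letter_of_le _ (by lia), letter_of_le _ (by lia), k1, h3]
    · exact hl
    · exact absurd h3 (k2 i hl (by lia))
  · rintro ⟨ha, rfl⟩
    have hlt := List.idxOf_lt_length_of_mem ha
    obtain ⟨k1, k2⟩ := letter_lastPos ha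
    refine ⟨by lia, by lia, ?_, fun l hl hl' => ?_⟩
    · rw [letter_last, letter_of_le _ (by lia), k1]
    · rw [letter_of_le _ (by lia), letter_of_le _ (by lia), k1]
      exact k2 l hl (by lia)

lemma step_iff {h : List ℕ} {a : ℕ} (hh : IsRG h) :
    Step h a ↔ ∀ i₁ i₂, IsArc (letter (a :: h)) i₁ (h.length + 1) →
      IsArc (letter h) i₂ h.length → ¬ i₁ < i₂ := by
  cases h with
  | nil =>
    refine iff_of_true (fun b g hbg => by simp at hbg) ?_
    rintro i₁ i₂ - ⟨h1, h2, -⟩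
    simp at h2
  | cons b g =>
    simp only [isArc_letter_last]
    rw [List.length_cons]
    simp only [isArc_letter_last]
    have hmem : ∀ c, c ∈ b :: g ↔ c < numLabels (b :: g) := fun c => hh.mem_iff
    have hmem' : ∀ c, c ∈ g ↔ c < numLabels g := fun c => hh.1.mem_iff
    have hinj : a ∈ g → (g.idxOf a = g.idxOf b ↔ a = b) := fun hag => List.idxOf_inj hag
    have hlt : a ∈ g → g.idxOf a < g.length := fun hag => List.idxOf_lt_length_of_mem hag
    constructor
    · rintro hs i₁ i₂ ⟨ha, rfl⟩ ⟨hb, rfl⟩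
      have := hs b g rfl ((hmem a).1 ha) ((hmem' b).1 hb)
      rw [List.idxOf_cons]
      have hltb := List.idxOf_lt_length_of_mem hb
      grind
    · intro hs b' g' hbg ha hb
      obtain ⟨rfl, rfl⟩ := List.cons.inj hbg
      have hb' := (hmem' b).2 hb
      have ha' := (hmem a).2 ha
      have := hs _ _ ⟨ha', rfl⟩ ⟨hb', rfl⟩
      rw [List.idxOf_cons] at this
      have hltb := List.idxOf_lt_length_of_mem hb'
      grind

lemma isLegal_iff {l : List ℕ} (h : IsRG l) :
    IsLegal l ↔ ∀ i₁ i₂ p, p + 1 ≤ l.length → IsArc (letter l) i₁ (p + 1) →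
      IsArc (letter l) i₂ p → ¬ i₁ < i₂ := by
  induction l with
  | nil => simp [IsLegal]
  | cons a g ih =>
    rw [IsLegal, ih h.1, step_iff h.1]
    constructor
    · rintro ⟨h1, h2⟩ i₁ i₂ p hp hi1 hi2
      rw [List.length_cons] at hp
      rw [isArc_letter_cons (by lia)] at hi2
      rcases eq_or_ne p g.length with rfl | hne
      · exact h2 _ _ hi1 hi2
      · rw [isArc_letter_cons (by lia)] at hi1
        exact h1 _ _ p (by lia) hi1 hi2
    · intro h1
      refine ⟨fun i₁ i₂ p hp hi1 hi2 => h1 i₁ i₂ p (by simp; lia) ?_ ?_, fun i₁ i₂ hi1 hi2 =>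
        h1 i₁ i₂ g.length (by simp) hi1 ?_⟩
      · rwa [isArc_letter_cons hp]
      · rwa [isArc_letter_cons (by lia)]
      · rwa [isArc_letter_cons le_rfl]

lemma avoids_rightNesting_iff {l : List ℕ} {π : SetPartition l.length}
    (hπ : IsLabelling π (letter l)) (h : IsRG l) : Avoids π RightNesting ↔ IsLegal l := by
  rw [isLegal_iff h]
  constructor
  · intro hA i₁ i₂ p hp h1 h2 hlt
    exact hA (i₁, p + 1) (hπ.mem_arcs_iff.2 ⟨hp, h1⟩) (i₂, p) (hπ.mem_arcs_iff.2 ⟨by lia, h2⟩)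
      ⟨⟨hlt, h2.2.1, by simp⟩, rfl⟩
  · rintro hA ⟨i₁, j₁⟩ he ⟨i₂, j₂⟩ hf ⟨⟨h1, -, -⟩, h4⟩
    simp only at h1 h4
    subst h4
    exact hA i₁ i₂ j₂ (hπ.mem_arcs_iff.1 he).1 (hπ.mem_arcs_iff.1 he).2 (hπ.mem_arcs_iff.1 hf).2 h1

/-! ### Endpoints of arcs -/

/-- The left endpoints of the arcs of `π`. -/
def openers {n : ℕ} (π : SetPartition n) : Finset ℕ := (arcs π).image Prod.fst

/-- The right endpoints of the arcs of `π`. -/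
def closers {n : ℕ} (π : SetPartition n) : Finset ℕ := (arcs π).image Prod.snd

lemma mem_openers {n : ℕ} {π : SetPartition n} {p : ℕ} : p ∈ openers π ↔ ∃ q, (p, q) ∈ arcs π := by
  simp [openers]

lemma mem_closers {n : ℕ} {π : SetPartition n} {q : ℕ} : q ∈ closers π ↔ ∃ p, (p, q) ∈ arcs π := by
  simp [closers]

lemma card_openers {n : ℕ} (π : SetPartition n) : (openers π).card = (arcs π).card := by
  refine card_image_of_injOn ?_
  rintro ⟨i, j⟩ h ⟨i', j'⟩ h' (rfl : i = i')
  rw [arc_right_unique h h']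

lemma card_closers {n : ℕ} (π : SetPartition n) : (closers π).card = (arcs π).card := by
  refine card_image_of_injOn ?_
  rintro ⟨i, j⟩ h ⟨i', j'⟩ h' (rfl : j = j')
  rw [arc_left_unique h h']

lemma openers_subset {n : ℕ} (π : SetPartition n) : openers π ⊆ Icc 1 n := by
  intro p hp
  obtain ⟨q, hq⟩ := mem_openers.1 hp
  have := arc_bounds hq
  exact mem_Icc.2 (by lia)

lemma closers_subset {n : ℕ} (π : SetPartition n) : closers π ⊆ Icc 1 n := by
  intro p hp
  obtain ⟨q, hq⟩ := mem_closers.1 hp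
  have := arc_bounds hq
  exact mem_Icc.2 (by lia)

lemma IsLabelling.mem_openers_iff {n : ℕ} {α : Type*} {π : SetPartition n} {f : ℕ → α}
    (h : IsLabelling π f) {p : ℕ} :
    p ∈ openers π ↔ ∃ q, 1 ≤ p ∧ p < q ∧ q ≤ n ∧ f p = f q := by
  rw [mem_openers]
  constructor
  · rintro ⟨q, hq⟩
    have := h.mem_arcs.1 hq
    exact ⟨q, this.1, this.2.2.1, this.2.1, this.2.2.2.1⟩
  · rintro ⟨q, h1, h2, h3, h4⟩
    exact h.exists_arc_right h1 h2 h3 h4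

lemma IsLabelling.mem_closers_iff {n : ℕ} {α : Type*} {π : SetPartition n} {f : ℕ → α}
    (h : IsLabelling π f) {q : ℕ} :
    q ∈ closers π ↔ ∃ p, 1 ≤ p ∧ p < q ∧ q ≤ n ∧ f p = f q := by
  rw [mem_closers]
  constructor
  · rintro ⟨p, hp⟩
    have := h.mem_arcs.1 hp
    exact ⟨p, this.1, this.2.2.1, this.2.1, this.2.2.2.1⟩
  · rintro ⟨p, h1, h2, h3, h4⟩
    exact h.exists_arc_left h1 h2 h3 h4

lemma IsLabelling.injOn_sdiff_closers {n : ℕ} {α : Type*} {π : SetPartition n} {f : ℕ → α}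
    (h : IsLabelling π f) : Set.InjOn f (Icc 1 n \ closers π : Finset ℕ) := by
  intro p hp q hq e
  rw [mem_coe, mem_sdiff, mem_Icc, h.mem_closers_iff] at hp hq
  rcases lt_trichotomy p q with hl | hl | hl
  · exact absurd ⟨p, by lia, hl, by lia, e⟩ hq.2
  · exact hl
  · exact absurd ⟨q, by lia, hl, by lia, e.symm⟩ hp.2

/-- Every block contains an element that is not a right endpoint, namely its minimum. -/
lemma IsLabelling.exists_not_mem_closers {n : ℕ} {α : Type*} {π : SetPartition n} {f : ℕ → α}
    (h : IsLabelling π f) {p : ℕ} (hp : p ∈ Icc 1 n) :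
    ∃ r ∈ Icc 1 n \ closers π, r ≤ p ∧ f r = f p := by
  induction p using Nat.strong_induction_on with
  | _ p ih =>
    by_cases hc : p ∈ closers π
    · obtain ⟨q, h1, h2, h3, h4⟩ := h.mem_closers_iff.1 hc
      obtain ⟨r, hr, hr1, hr2⟩ := ih q h2 (mem_Icc.2 (by lia))
      exact ⟨r, hr, by lia, hr2.trans h4⟩
    · exact ⟨p, mem_sdiff.2 ⟨hp, hc⟩, le_rfl, rfl⟩

/-! ### Statistics of words -/

lemma card_arcs_add_numLabels {l : List ℕ} {π : SetPartition l.length}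
    (hπ : IsLabelling π (letter l)) (h : IsRG l) : (arcs π).card + numLabels l = l.length := by
  have h1 : (Icc 1 l.length \ closers π).image (letter l) = range (numLabels l) := by
    ext a
    rw [mem_range, ← h.mem_iff, mem_iff_letter, mem_image]
    constructor
    · rintro ⟨p, hp, rfl⟩
      rw [mem_sdiff, mem_Icc] at hp
      exact ⟨p, hp.1.1, hp.1.2, rfl⟩
    · rintro ⟨p, hp, hp', rfl⟩
      obtain ⟨r, hr, -, e⟩ := hπ.exists_not_mem_closers (mem_Icc.2 ⟨hp, hp'⟩)
      exact ⟨r, hr, e⟩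
  have h2 := card_image_of_injOn hπ.injOn_sdiff_closers
  rw [h1, card_range, card_sdiff_of_subset (closers_subset π), card_closers, Nat.card_Icc] at h2
  have h3 := card_le_card (closers_subset π)
  rw [card_closers, Nat.card_Icc] at h3
  lia

lemma exists_mem_code_iff {l : List ℕ} (h : IsRG l) {i : ℕ} : (∃ j, i ∈ code l j) ↔
    ∃ p q, 1 ≤ p ∧ p < q ∧ q ≤ l.length ∧ letter l p = i ∧ letter l q = i := by
  induction l with
  | nil => simp [code]
  | cons a g ih =>
    have ih := ih h.1
    have hmem := h.1.mem_iff (a := a)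
    have ha := h.2
    have h1 : (∃ p q, 1 ≤ p ∧ p < q ∧ q ≤ (a :: g).length ∧ letter (a :: g) p = i ∧
        letter (a :: g) q = i) ↔ (a = i ∧ a ∈ g) ∨ ∃ j, i ∈ code g j := by
      rw [ih]
      constructor
      · rintro ⟨p, q, h1, h2, h3, h4, h5⟩
        rw [List.length_cons] at h3
        rw [letter_of_le _ (by lia)] at h4
        rcases eq_or_ne q (g.length + 1) with rfl | hne
        · rw [letter_last] at h5
          exact Or.inl ⟨h5, mem_iff_letter.2 ⟨p, h1, by lia, h4.trans h5.symm⟩⟩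
        · rw [letter_of_le _ (by lia)] at h5
          exact Or.inr ⟨p, q, h1, h2, by lia, h4, h5⟩
      · rintro (⟨rfl, hag⟩ | ⟨p, q, h1, h2, h3, h4, h5⟩)
        · obtain ⟨p, hp, hp', e⟩ := mem_iff_letter.1 hag
          exact ⟨p, g.length + 1, hp, by lia, by simp, by rwa [letter_of_le _ hp'], letter_last _ _⟩
        · exact ⟨p, q, h1, h2, by simp; lia, by rwa [letter_of_le _ (by lia)],
            by rwa [letter_of_le _ (by lia)]⟩
    rw [h1, code]
    split_ifs with hN
    · rw [or_iff_right]
      rintro ⟨-, h2⟩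
      have := hmem.1 h2
      lia
    · have hag := hmem.2 (by lia)
      constructor
      · rintro ⟨j, hj⟩
        rw [Function.update_apply] at hj
        split_ifs at hj with hj'
        · rcases Multiset.mem_cons.1 hj with rfl | hj
          · exact Or.inl ⟨rfl, hag⟩
          · exact Or.inr ⟨_, hj⟩
        · exact Or.inr ⟨_, hj⟩
      · rintro (⟨rfl, -⟩ | ⟨j, hj⟩)
        · exact ⟨numLabels g - 1, by simp⟩
        · refine ⟨j, ?_⟩
          rw [Function.update_apply]
          split_ifs with hj'
          · exact Multiset.mem_cons_of_mem (hj' ▸ hj)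
          · exact hj

lemma transientCount_add_card_sdiff {n : ℕ} (π : SetPartition n) :
    transientCount π + (openers π \ closers π).card = (arcs π).card := by
  obtain ⟨f, hf⟩ := exists_isLabelling π
  have : transientCount π = (openers π ∩ closers π).card := by
    unfold transientCount
    congr 1
    ext x
    rw [mem_filter, mem_inter, hf.mem_openers_iff, hf.mem_closers_iff, mem_Icc]
    constructor
    · rintro ⟨hx, B, hB, hxB, ⟨a, ha, hax⟩, b, hb, hbx⟩
      exact ⟨⟨b, hx.1, hbx, (mem_Icc.1 (π.le hB hb)).2, hf.eq_of_mem hB hxB hb⟩,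
        ⟨a, (mem_Icc.1 (π.le hB ha)).1, hax, hx.2, hf.eq_of_mem hB ha hxB⟩⟩
    · rintro ⟨⟨b, h1, h2, h3, h4⟩, ⟨a, k1, k2, k3, k4⟩⟩
      obtain ⟨B, hB, hxB⟩ := π.exists_mem (a := x) (mem_Icc.2 ⟨h1, k3⟩)
      exact ⟨⟨h1, k3⟩, B, hB, hxB, ⟨a, hf.mem_of_eq hB hxB (mem_Icc.2 (by lia)) k4.symm, k2⟩,
        ⟨b, hf.mem_of_eq hB hxB (mem_Icc.2 (by lia)) h4, h2⟩⟩
  rw [this, card_inter_add_card_sdiff, card_openers]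

lemma card_rows_code {l : List ℕ} {π : SetPartition l.length}
    (hπ : IsLabelling π (letter l)) (h : IsRG l) :
    (rows (numLabels l) (code l)).card = (openers π \ closers π).card := by
  have h1 : (openers π \ closers π).image (letter l) = rows (numLabels l) (code l) := by
    ext i
    have h2 : i ∈ rows (numLabels l) (code l) ↔ ∃ j, i ∈ code l j := by
      rw [mem_rows]
      refine ⟨fun ⟨j, _, hj⟩ => ⟨j, hj⟩, fun ⟨j, hj⟩ => ⟨j, ?_, hj⟩⟩
      by_contra hlt
      rw [(code_mem_le h).2 j (by lia)] at hj
      simp at hj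
    rw [h2, exists_mem_code_iff h, mem_image]
    constructor
    · rintro ⟨p, hp, rfl⟩
      obtain ⟨q, h1, h2, h3, h4⟩ := hπ.mem_openers_iff.1 (mem_sdiff.1 hp).1
      exact ⟨p, q, h1, h2, h3, rfl, h4.symm⟩
    · rintro ⟨p, q, h1, h2, h3, h4, h5⟩
      obtain ⟨r, hr, hrp, e⟩ := hπ.exists_not_mem_closers (p := p) (mem_Icc.2 (by lia))
      rw [mem_sdiff, mem_Icc] at hr
      exact ⟨r, mem_sdiff.2 ⟨hπ.mem_openers_iff.2 ⟨q, hr.1.1, by lia, h3, by rw [e, h4, h5]⟩, hr.2⟩,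
        e.trans h4⟩
  rw [← h1]
  exact card_image_of_injOn (hπ.injOn_sdiff_closers.mono fun p hp => by
    rw [mem_coe, mem_sdiff] at hp ⊢
    exact ⟨openers_subset π hp.1, hp.2⟩)

/-! ### Partitions without right nestings and codes -/

/-- The partition of the positions of a word according to the letters they carry. -/
noncomputable def wordPartition (m : ℕ) (l : List ℕ) : SetPartition m :=
  (exists_partition_isLabelling m (letter l)).choose

lemma isLabelling_wordPartition (m : ℕ) (l : List ℕ) :
    IsLabelling (wordPartition m l) (letter l) :=
  (exists_partition_isLabelling m (letter l)).choose_spec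

lemma wordPartition_bijOn (S k : ℕ) :
    Set.BijOn (wordPartition (S + k)) (Words S k) (T (S + k) k) := by
  refine ⟨?_, ?_, ?_⟩
  · rintro l ⟨h1, h2, rfl, h4⟩
    rw [← h4]
    have hπ := isLabelling_wordPartition l.length l
    have := card_arcs_add_numLabels hπ h1
    exact ⟨by lia, (avoids_rightNesting_iff hπ h1).2 h2⟩
  · rintro l ⟨h1, h2, h3, h4⟩ l' ⟨h1', h2', h3', h4'⟩ e
    have hπ := isLabelling_wordPartition (S + k) l
    have hπ' := isLabelling_wordPartition (S + k) l'
    rw [← e] at hπ'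
    refine h1.ext h1' (h4.trans h4'.symm) fun p hp q hq => ?_
    rw [h4] at hp hq
    rw [hπ p hp q hq, hπ' p hp q hq]
  · rintro π ⟨hk, hA⟩
    obtain ⟨f, hf⟩ := exists_isLabelling π
    obtain ⟨l, hl, h1, hlf⟩ := exists_isRG f (S + k)
    have hπ : IsLabelling π (letter l) := hf.congr hlf
    have e : wordPartition (S + k) l = π :=
      (isLabelling_wordPartition _ l).unique hπ fun _ _ _ _ => Iff.rfl
    refine ⟨l, ?_, e⟩
    clear e hf hlf
    generalize hm : S + k = m at *
    subst hl
    have := card_arcs_add_numLabels hπ h1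
    exact ⟨h1, (avoids_rightNesting_iff hπ h1).1 hA, by lia, by lia⟩

theorem exists_equiv_T_codes (S k : ℕ) : ∃ e : T (S + k) k ≃ Codes S k,
    ∀ π : T (S + k) k, transientCount π.1 + (rows S (e π).1).card = k := by
  let e₁ := (wordPartition_bijOn S k).equiv
  let e₂ := (code_bijOn S k).equiv
  refine ⟨e₁.symm.trans e₂, fun π => ?_⟩
  obtain ⟨⟨l, hl⟩, rfl⟩ := e₁.surjective π
  rw [Equiv.trans_apply, Equiv.symm_apply_apply]
  change transientCount (wordPartition (S + k) l) + (rows S (code l)).card = k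
  obtain ⟨h1, h2, rfl, h4⟩ := hl
  rw [← h4]
  have hπ := isLabelling_wordPartition l.length l
  rw [card_rows_code hπ h1, transientCount_add_card_sdiff]
  have := card_arcs_add_numLabels hπ h1
  lia

/-! ### The code of a partial matching -/

lemma isPartialMatching_iff {n : ℕ} {π : SetPartition n} :
    IsPartialMatching π ↔ Disjoint (openers π) (closers π) := by
  obtain ⟨f, hf⟩ := exists_isLabelling π
  rw [disjoint_left]
  constructor
  · intro h p hp hp'
    obtain ⟨q, h1, h2, h3, h4⟩ := hf.mem_openers_iff.1 hp
    obtain ⟨r, k1, k2, k3, k4⟩ := hf.mem_closers_iff.1 hp'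
    obtain ⟨B, hB, hpB⟩ := π.exists_mem (a := p) (mem_Icc.2 ⟨h1, k3⟩)
    have := h B hB
    refine absurd (two_lt_card.2 ⟨p, hpB, q, hf.mem_of_eq hB hpB (mem_Icc.2 (by lia)) h4,
      r, hf.mem_of_eq hB hpB (mem_Icc.2 (by lia)) k4.symm, by lia, by lia, by lia⟩) (by lia)
  · intro h B hB
    by_contra hlt
    obtain ⟨a, ha, b, hb, c, hc, hab, hac, hbc⟩ := two_lt_card.1 (not_le.1 hlt)
    have key : ∀ x ∈ B, ∀ y ∈ B, ∀ z ∈ B, x < y → ¬ y < z := by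
      intro x hx y hy z hz hxy hyz
      have h1 := mem_Icc.1 (π.le hB hx)
      have h2 := mem_Icc.1 (π.le hB hz)
      exact h (hf.mem_openers_iff.2 ⟨z, by lia, hyz, h2.2, hf.eq_of_mem hB hy hz⟩)
        (hf.mem_closers_iff.2 ⟨x, h1.1, hxy, by lia, hf.eq_of_mem hB hx hy⟩)
    have := key a ha b hb c hc
    have := key a ha c hc b hb
    have := key b hb a ha c hc
    have := key b hb c hc a ha
    have := key c hc a ha b hb
    have := key c hc b hb a ha
    lia

/-- The elements of `[n]` that are not endpoints of arcs, i.e. the singleton blocks. -/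
def singletons {n : ℕ} (π : SetPartition n) : Finset ℕ := Icc 1 n \ (openers π ∪ closers π)

/-- The number of singleton blocks weakly to the left of `p`: the index of the segment that
contains `p` when `[n]` is cut before each singleton block. -/
def segment {n : ℕ} (π : SetPartition n) (p : ℕ) : ℕ :=
  ((singletons π).filter (· ≤ p)).card

lemma segment_mono {n : ℕ} (π : SetPartition n) : Monotone (segment π) := fun _ _ h =>
  card_le_card fun _ hx => mem_filter.2 ⟨(mem_filter.1 hx).1, (mem_filter.1 hx).2.trans h⟩

lemma segment_succ {n : ℕ} (π : SetPartition n) (p : ℕ) :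
    segment π (p + 1) = segment π p + if p + 1 ∈ singletons π then 1 else 0 := by
  unfold segment
  split_ifs with h
  · rw [← card_insert_of_notMem (a := p + 1) (by simp)]
    congr 1
    ext x
    rw [mem_insert, mem_filter, mem_filter]
    constructor
    · rintro ⟨h1, h2⟩
      rcases eq_or_ne x (p + 1) with e | e
      · exact Or.inl e
      · exact Or.inr ⟨h1, by lia⟩
    · rintro (rfl | ⟨h1, h2⟩)
      · exact ⟨h, le_rfl⟩
      · exact ⟨h1, by lia⟩
  · rw [add_zero]
    congr 1
    ext x
    rw [mem_filter, mem_filter]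
    refine and_congr_right fun hx => ?_
    have : x ≠ p + 1 := fun e => h (e ▸ hx)
    lia

lemma card_singletons {n : ℕ} {π : SetPartition n} (h : IsPartialMatching π) :
    (singletons π).card + 2 * (arcs π).card = n := by
  have h1 := card_union_of_disjoint (isPartialMatching_iff.1 h)
  rw [card_openers, card_closers] at h1
  have h2 : openers π ∪ closers π ⊆ Icc 1 n := union_subset (openers_subset π) (closers_subset π)
  have h3 := card_sdiff_add_card_eq_card h2
  rw [Nat.card_Icc] at h3
  unfold singletons
  lia

/-- The code of a partial matching: `matchingCode π j` collects the segments of the left endpoints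
of the arcs that end in segment `j`. -/
def matchingCode {n : ℕ} (π : SetPartition n) (j : ℕ) : Multiset ℕ :=
  ((arcs π).filter fun e => segment π e.2 = j).val.map fun e => segment π e.1

lemma mem_matchingCode {n : ℕ} {π : SetPartition n} {i j : ℕ} :
    i ∈ matchingCode π j ↔ ∃ e ∈ arcs π, segment π e.2 = j ∧ segment π e.1 = i := by
  simp [matchingCode, and_assoc]

lemma count_matchingCode {n : ℕ} (π : SetPartition n) (i j : ℕ) :
    (matchingCode π j).count i =
      ((arcs π).filter fun e => segment π e.1 = i ∧ segment π e.2 = j).card := by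
  rw [matchingCode, Multiset.count_map, card_def]
  congr 1
  rw [← filter_val, filter_filter]
  congr 1
  ext e
  simp only [mem_filter]
  tauto

lemma sum_card_matchingCode {n S : ℕ} {π : SetPartition n}
    (h : ∀ e ∈ arcs π, segment π e.2 < S) :
    ∑ j ∈ range S, (matchingCode π j).card = (arcs π).card := by
  rw [card_eq_sum_card_fiberwise (f := fun e => segment π e.2) (t := range S)
    (fun e he => by simpa using h e he)]
  simp only [matchingCode, Multiset.card_map]
  rfl

lemma matchingCode_mem_codes {n k S : ℕ} (hn : n + 1 = S + 2 * k) {π : SetPartition n}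
    (hπ : IsPartialMatching π) (hk : (arcs π).card = k) : matchingCode π ∈ Codes S k := by
  have hlt : ∀ p, segment π p < S := by
    intro p
    have h1 := card_singletons hπ
    have h2 := card_le_card (filter_subset (· ≤ p) (singletons π))
    unfold segment
    lia
  refine ⟨?_, ?_, ?_⟩
  · intro j i hi
    obtain ⟨⟨p, q⟩, he, rfl, rfl⟩ := mem_matchingCode.1 hi
    exact segment_mono π (arc_bounds he).2.1.le
  · intro j hj
    refine Multiset.eq_zero_of_forall_notMem fun i hi => ?_
    obtain ⟨e, he, rfl, rfl⟩ := mem_matchingCode.1 hi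
    have := hlt e.2
    lia
  · rw [sum_card_matchingCode fun e _ => hlt e.2, hk]

/-- The number of arcs parallel to `e`, i.e. with endpoints in the same two segments, that start to
the left of `e`. -/
def rank {n : ℕ} (π : SetPartition n) (e : ℕ × ℕ) : ℕ :=
  ((arcs π).filter fun e' => (segment π e'.1 = segment π e.1 ∧ segment π e'.2 = segment π e.2) ∧
    e'.1 < e.1).card

lemma rank_lt_rank {n : ℕ} {π : SetPartition n} {e e' : ℕ × ℕ} (he : e ∈ arcs π)
    (h1 : segment π e.1 = segment π e'.1) (h2 : segment π e.2 = segment π e'.2)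
    (h : e.1 < e'.1) : rank π e < rank π e' := by
  refine card_lt_card (ssubset_iff_of_subset ?_ |>.2 ⟨e, ?_, ?_⟩)
  · intro x hx
    rw [mem_filter] at hx ⊢
    exact ⟨hx.1, ⟨hx.2.1.1.trans h1, hx.2.1.2.trans h2⟩, hx.2.2.trans h⟩
  · exact mem_filter.2 ⟨he, ⟨h1, h2⟩, h⟩
  · simp

lemma rank_lt_count {n : ℕ} {π : SetPartition n} {e : ℕ × ℕ} (he : e ∈ arcs π) :
    rank π e < (matchingCode π (segment π e.2)).count (segment π e.1) := by
  rw [count_matchingCode]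
  refine card_lt_card (ssubset_iff_of_subset ?_ |>.2 ⟨e, ?_, ?_⟩)
  · intro x hx
    rw [mem_filter] at hx ⊢
    exact ⟨hx.1, hx.2.1⟩
  · exact mem_filter.2 ⟨he, rfl, rfl⟩
  · simp

/-! ### Names of the elements of a matching -/

/-- Quadruples of natural numbers in lexicographic order. They name the elements of `[n]` in a
matching: a singleton block that opens segment `j` is `(j, 0, 0, 0)`, and the endpoints of the
`t`-th arc from segment `i` to segment `j` are `(i, 1, j, t)` and `(j, 2, i, t)`. -/
abbrev Key : Type := ℕ ×ₗ ℕ ×ₗ ℕ ×ₗ ℕ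

/-- The quadruple `(a, b, c, d)` as an element of the lexicographic order. -/
def key (a b c d : ℕ) : Key := toLex (a, toLex (b, toLex (c, d)))

lemma key_lt_key {a b c d a' b' c' d' : ℕ} : key a b c d < key a' b' c' d' ↔
    a < a' ∨ a = a' ∧ (b < b' ∨ b = b' ∧ (c < c' ∨ c = c' ∧ d < d')) := by
  simp [key, Prod.Lex.toLex_lt_toLex]

lemma key_inj {a b c d a' b' c' d' : ℕ} : key a b c d = key a' b' c' d' ↔
    a = a' ∧ b = b' ∧ c = c' ∧ d = d' := by
  simp [key]

/-- Names of the two endpoints of an arc are identified by passing to the left endpoint. -/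
def blockKey (x : Key) : Key :=
  if (ofLex (ofLex x).2).1 = 2 then
    key (ofLex (ofLex (ofLex x).2).2).1 1 (ofLex x).1 (ofLex (ofLex (ofLex x).2).2).2
  else x

lemma blockKey_two (a c d : ℕ) : blockKey (key a 2 c d) = key c 1 a d := rfl

lemma blockKey_of_ne (a : ℕ) {b : ℕ} (c d : ℕ) (h : b ≠ 2) : blockKey (key a b c d) = key a b c d :=
  if_neg h

/-- The nonempty positions of the matrix encoded by `C`, with multiplicity: `⟨j, i, t⟩` stands for
the `t`-th copy of `i` in `C j`. -/
def cells (S : ℕ) (C : ℕ → Multiset ℕ) : Finset (Σ _ : ℕ, ℕ × ℕ) :=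
  (range S).sigma fun j => (C j).toEnumFinset

lemma mem_cells {S : ℕ} {C : ℕ → Multiset ℕ} {j i t : ℕ} :
    (⟨j, i, t⟩ : Σ _ : ℕ, ℕ × ℕ) ∈ cells S C ↔ j < S ∧ t < (C j).count i := by
  simp [cells]

lemma card_cells {S k : ℕ} {C : ℕ → Multiset ℕ} (hC : C ∈ Codes S k) : (cells S C).card = k := by
  rw [cells, card_sigma]
  simpa using hC.2.2

/-- The names of the elements of a matching with code `C`. -/
def keys (S : ℕ) (C : ℕ → Multiset ℕ) : Finset Key :=
  (Ioo 0 S).image (fun j => key j 0 0 0) ∪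
    ((cells S C).image (fun x => key x.2.1 1 x.1 x.2.2) ∪
      (cells S C).image (fun x => key x.1 2 x.2.1 x.2.2))

lemma mem_keys {S k : ℕ} {C : ℕ → Multiset ℕ} (hC : C ∈ Codes S k) {x : Key} :
    x ∈ keys S C ↔ (∃ j, 0 < j ∧ j < S ∧ x = key j 0 0 0) ∨
      (∃ i j t, t < (C j).count i ∧ x = key i 1 j t) ∨
      ∃ i j t, t < (C j).count i ∧ x = key j 2 i t := by
  have hS : ∀ {i j t}, t < (C j).count i → j < S := by
    intro i j t ht
    by_contra hj
    rw [hC.2.1 j (by lia)] at ht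
    simp at ht
  simp only [keys, mem_union, mem_image, mem_Ioo]
  refine or_congr ⟨?_, ?_⟩ (or_congr ⟨?_, ?_⟩ ⟨?_, ?_⟩)
  · rintro ⟨j, hj, rfl⟩
    exact ⟨j, hj.1, hj.2, rfl⟩
  · rintro ⟨j, h1, h2, rfl⟩
    exact ⟨j, ⟨h1, h2⟩, rfl⟩
  · rintro ⟨⟨j, i, t⟩, h, rfl⟩
    exact ⟨i, j, t, (mem_cells.1 h).2, rfl⟩
  · rintro ⟨i, j, t, h, rfl⟩
    exact ⟨⟨j, i, t⟩, mem_cells.2 ⟨hS h, h⟩, rfl⟩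
  · rintro ⟨⟨j, i, t⟩, h, rfl⟩
    exact ⟨i, j, t, (mem_cells.1 h).2, rfl⟩
  · rintro ⟨i, j, t, h, rfl⟩
    exact ⟨⟨j, i, t⟩, mem_cells.2 ⟨hS h, h⟩, rfl⟩

lemma card_keys {n S k : ℕ} (hS : 0 < S) (hn : n + 1 = S + 2 * k) {C : ℕ → Multiset ℕ}
    (hC : C ∈ Codes S k) : (keys S C).card = n := by
  rw [keys, card_union_of_disjoint, card_union_of_disjoint, card_image_of_injective,
    card_image_of_injective, card_image_of_injective, card_cells hC, Nat.card_Ioo]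
  · lia
  · rintro ⟨j, i, t⟩ ⟨j', i', t'⟩ h
    obtain ⟨rfl, -, rfl, rfl⟩ := key_inj.1 h
    rfl
  · rintro ⟨j, i, t⟩ ⟨j', i', t'⟩ h
    obtain ⟨rfl, -, rfl, rfl⟩ := key_inj.1 h
    rfl
  · intro j j' h
    exact (key_inj.1 h).1
  · rw [disjoint_left]
    intro x hx hx'
    obtain ⟨y, -, rfl⟩ := mem_image.1 hx
    obtain ⟨z, -, h⟩ := mem_image.1 hx'
    simp [key_inj] at h
  · rw [disjoint_left]
    intro x hx hx'
    obtain ⟨y, -, rfl⟩ := mem_image.1 hx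
    rcases mem_union.1 hx' with hx' | hx' <;>
    · obtain ⟨z, -, h⟩ := mem_image.1 hx'
      simp [key_inj] at h

open Classical in
/-- The name of the element `p` in the matching `π`. -/
noncomputable def nameOf {n : ℕ} (π : SetPartition n) (p : ℕ) : Key :=
  if h : ∃ q, (p, q) ∈ arcs π then
    key (segment π p) 1 (segment π h.choose) (rank π (p, h.choose))
  else if h : ∃ r, (r, p) ∈ arcs π then
    key (segment π p) 2 (segment π h.choose) (rank π (h.choose, p))
  else key (segment π p) 0 0 0

lemma nameOf_left {n : ℕ} {π : SetPartition n} {p q : ℕ} (h : (p, q) ∈ arcs π) :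
    nameOf π p = key (segment π p) 1 (segment π q) (rank π (p, q)) := by
  have h' : ∃ q, (p, q) ∈ arcs π := ⟨q, h⟩
  rw [nameOf, dif_pos h', arc_right_unique h'.choose_spec h]

lemma nameOf_right {n : ℕ} {π : SetPartition n} (hπ : IsPartialMatching π) {p q : ℕ}
    (h : (p, q) ∈ arcs π) : nameOf π q = key (segment π q) 2 (segment π p) (rank π (p, q)) := by
  have h' : ∃ p, (p, q) ∈ arcs π := ⟨p, h⟩
  have h0 : ¬ ∃ r, (q, r) ∈ arcs π := fun h0 =>
    disjoint_right.1 (isPartialMatching_iff.1 hπ) (mem_closers.2 h') (mem_openers.2 h0)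
  rw [nameOf, dif_neg h0, dif_pos h', arc_left_unique h'.choose_spec h]

lemma nameOf_singleton {n : ℕ} {π : SetPartition n} {p : ℕ} (h : p ∈ singletons π) :
    nameOf π p = key (segment π p) 0 0 0 := by
  rw [singletons, mem_sdiff, mem_union, mem_openers, mem_closers] at h
  rw [nameOf, dif_neg fun h' => h.2 (Or.inl h'), dif_neg fun h' => h.2 (Or.inr h')]

lemma trichotomy {n : ℕ} (π : SetPartition n) {p : ℕ} (hp : p ∈ Icc 1 n) :
    p ∈ singletons π ∨ (∃ q, (p, q) ∈ arcs π) ∨ ∃ q, (q, p) ∈ arcs π := by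
  rw [singletons, mem_sdiff, mem_union, mem_openers, mem_closers]
  tauto

lemma not_mem_singletons_left {n : ℕ} {π : SetPartition n} {p q : ℕ} (h : (p, q) ∈ arcs π) :
    p ∉ singletons π := fun hs =>
  (mem_sdiff.1 hs).2 (mem_union_left _ (mem_openers.2 ⟨q, h⟩))

lemma not_mem_singletons_right {n : ℕ} {π : SetPartition n} {p q : ℕ} (h : (p, q) ∈ arcs π) :
    q ∉ singletons π := fun hs =>
  (mem_sdiff.1 hs).2 (mem_union_right _ (mem_closers.2 ⟨p, h⟩))

lemma R.not_closer_opener {n k : ℕ} {π : SetPartition n} (hπ : π ∈ R n k) {r p q : ℕ}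
    (h : (r, p) ∈ arcs π) : (p + 1, q) ∉ arcs π := fun h' =>
  hπ.2.2.1 _ h _ h' ⟨⟨(arc_bounds h).2.1, by simp, (arc_bounds h').2.1⟩, rfl⟩

lemma R.lt_of_openers {n k : ℕ} {π : SetPartition n} (hπ : π ∈ R n k) {p q q' : ℕ}
    (h : (p, q) ∈ arcs π) (h' : (p + 1, q') ∈ arcs π) : q < q' := by
  rcases lt_trichotomy q q' with hl | rfl | hl
  · exact hl
  · have := arc_left_unique h h'
    lia
  · exact absurd ⟨⟨by simp, (arc_bounds h').2.1, hl⟩, rfl⟩ (hπ.2.2.2.1 _ h _ h')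

lemma R.lt_of_closers {n k : ℕ} {π : SetPartition n} (hπ : π ∈ R n k) {p q q' : ℕ}
    (h : (q, p) ∈ arcs π) (h' : (q', p + 1) ∈ arcs π) : q < q' := by
  rcases lt_trichotomy q q' with hl | rfl | hl
  · exact hl
  · have := arc_right_unique h h'
    lia
  · exact absurd ⟨⟨hl, (arc_bounds h).2.1, by simp⟩, rfl⟩ (hπ.2.2.2.2 _ h' _ h)

/-- The forbidden patterns of `R n k` say exactly that the names increase from left to right. -/
lemma strictMonoOn_nameOf {n k : ℕ} {π : SetPartition n} (hπ : π ∈ R n k) :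
    StrictMonoOn (nameOf π) (Icc 1 n : Finset ℕ) := by
  rw [coe_Icc]
  refine strictMonoOn_of_lt_add_one Set.ordConnected_Icc fun p _ hp hp' => ?_
  rw [← coe_Icc, mem_coe] at hp hp'
  have hseg := segment_succ π p
  rcases trichotomy π hp' with h' | ⟨q', h'⟩ | ⟨q', h'⟩
  · rw [if_pos h'] at hseg
    rw [nameOf_singleton h']
    rcases trichotomy π hp with h | ⟨q, h⟩ | ⟨q, h⟩
    · rw [nameOf_singleton h, key_lt_key]; lia
    · rw [nameOf_left h, key_lt_key]; lia
    · rw [nameOf_right hπ.1 h, key_lt_key]; lia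
  · rw [if_neg (not_mem_singletons_left h')] at hseg
    rw [nameOf_left h']
    rcases trichotomy π hp with h | ⟨q, h⟩ | ⟨q, h⟩
    · rw [nameOf_singleton h, key_lt_key]; lia
    · rw [nameOf_left h, key_lt_key]
      have h1 := segment_mono π (R.lt_of_openers hπ h h').le
      have h2 := rank_lt_rank (e' := (p + 1, q')) h hseg.symm
      have h3 : segment π q = segment π q' → rank π (p, q) < rank π (p + 1, q') :=
        fun e => h2 e (by simp)
      lia
    · exact absurd h' (R.not_closer_opener hπ h)
  · rw [if_neg (not_mem_singletons_right h')] at hseg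
    rw [nameOf_right hπ.1 h']
    rcases trichotomy π hp with h | ⟨q, h⟩ | ⟨q, h⟩
    · rw [nameOf_singleton h, key_lt_key]; lia
    · rw [nameOf_left h, key_lt_key]; lia
    · rw [nameOf_right hπ.1 h, key_lt_key]
      have h1 := segment_mono π (R.lt_of_closers hπ h h').le
      have h3 : segment π q = segment π q' → rank π (q, p) < rank π (q', p + 1) :=
        fun e => rank_lt_rank h e hseg.symm (R.lt_of_closers hπ h h')
      lia

lemma segment_pos {n : ℕ} {π : SetPartition n} {p : ℕ} (h : p ∈ singletons π) :
    0 < segment π p :=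
  card_pos.2 ⟨p, mem_filter.2 ⟨h, le_rfl⟩⟩

lemma nameOf_mem_keys {n S k : ℕ} (hn : n + 1 = S + 2 * k) {π : SetPartition n}
    (hπ : π ∈ R n k) {p : ℕ} (hp : p ∈ Icc 1 n) : nameOf π p ∈ keys S (matchingCode π) := by
  rw [mem_keys (matchingCode_mem_codes hn hπ.1 hπ.2.1)]
  rcases trichotomy π hp with h | ⟨q, h⟩ | ⟨q, h⟩
  · refine Or.inl ⟨_, segment_pos h, ?_, nameOf_singleton h⟩
    have h1 := card_singletons hπ.1
    have h2 := card_le_card (filter_subset (· ≤ p) (singletons π))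
    have h3 := hπ.2.1
    unfold segment
    lia
  · exact Or.inr (Or.inl ⟨_, _, _, rank_lt_count h, nameOf_left h⟩)
  · exact Or.inr (Or.inr ⟨_, _, _, rank_lt_count h, nameOf_right hπ.1 h⟩)

/-- A matching in `R n k` can be recovered from the names of its elements. -/
lemma isLabelling_blockKey_nameOf {n k : ℕ} {π : SetPartition n} (hπ : π ∈ R n k) :
    IsLabelling π fun p => blockKey (nameOf π p) := by
  obtain ⟨f, hf⟩ := exists_isLabelling π
  have key : ∀ p ∈ Icc 1 n, ∃ r ∈ Icc 1 n \ closers π, f r = f p ∧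
      blockKey (nameOf π p) = nameOf π r := by
    intro p hp
    have hdis := disjoint_left.1 (isPartialMatching_iff.1 hπ.1)
    rcases trichotomy π hp with h | ⟨q, h⟩ | ⟨q, h⟩
    · refine ⟨p, mem_sdiff.2 ⟨hp, fun h' => ?_⟩, rfl, ?_⟩
      · exact (mem_sdiff.1 h).2 (mem_union_right _ h')
      · rw [nameOf_singleton h, blockKey_of_ne _ _ _ (by lia)]
    · refine ⟨p, mem_sdiff.2 ⟨hp, hdis (mem_openers.2 ⟨q, h⟩)⟩, rfl, ?_⟩
      rw [nameOf_left h, blockKey_of_ne _ _ _ (by lia)]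
    · have := arc_bounds h
      refine ⟨q, mem_sdiff.2 ⟨mem_Icc.2 (by lia), hdis (mem_openers.2 ⟨p, h⟩)⟩,
        (hf.mem_arcs.1 h).2.2.2.1, ?_⟩
      rw [nameOf_left h, nameOf_right hπ.1 h, blockKey_two]
  refine hf.congr fun p hp q hq => ?_
  obtain ⟨r, hr, hrf, e⟩ := key p hp
  obtain ⟨r', hr', hrf', e'⟩ := key q hq
  simp only [e, e']
  rw [← hrf, ← hrf', (strictMonoOn_nameOf hπ).injOn.eq_iff (mem_coe.2 (mem_sdiff.1 hr).1)
    (mem_coe.2 (mem_sdiff.1 hr').1), hf.injOn_sdiff_closers.eq_iff (mem_coe.2 hr) (mem_coe.2 hr')]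

/-- Two strictly increasing enumerations of the same finite set by `1, …, n` coincide. -/
lemma eqOn_of_strictMonoOn {α : Type*} [LinearOrder α] {n : ℕ} {s : Finset α} (hs : s.card = n)
    {f g : ℕ → α} (hf : StrictMonoOn f (Icc 1 n : Finset ℕ))
    (hg : StrictMonoOn g (Icc 1 n : Finset ℕ)) (hfs : ∀ p ∈ Icc 1 n, f p ∈ s)
    (hgs : ∀ p ∈ Icc 1 n, g p ∈ s) : ∀ p ∈ Icc 1 n, f p = g p := by
  have hmem : ∀ x : Fin n, (x : ℕ) + 1 ∈ Icc 1 n := fun x => mem_Icc.2 (by lia)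
  have h : ∀ {f : ℕ → α}, StrictMonoOn f (Icc 1 n : Finset ℕ) → (∀ p ∈ Icc 1 n, f p ∈ s) →
      (fun x : Fin n => f (x + 1)) = s.orderEmbOfFin hs := fun hf hfs =>
    orderEmbOfFin_unique hs (fun x => hfs _ (hmem x)) fun x y hxy =>
      hf (mem_coe.2 (hmem x)) (mem_coe.2 (hmem y)) (by simpa using hxy)
  intro p hp
  have := congrFun ((h hf hfs).trans (h hg hgs).symm) ⟨p - 1, by rw [mem_Icc] at hp; lia⟩
  rwa [Nat.sub_add_cancel (mem_Icc.1 hp).1] at this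

lemma exists_strictMonoOn {α : Type*} [LinearOrder α] [Inhabited α] {n : ℕ} {s : Finset α}
    (hs : s.card = n) : ∃ f : ℕ → α, StrictMonoOn f (Icc 1 n : Finset ℕ) ∧
      (∀ p ∈ Icc 1 n, f p ∈ s) ∧ ∀ x ∈ s, ∃ p ∈ Icc 1 n, f p = x := by
  obtain ⟨f, hval⟩ : ∃ f : ℕ → α, ∀ i : Fin n, f (i + 1) = s.orderEmbOfFin hs i :=
    ⟨fun p => if h : p - 1 < n then s.orderEmbOfFin hs ⟨p - 1, h⟩ else default, fun i => by simp⟩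
  have hval' : ∀ p ∈ Icc 1 n, ∃ i : Fin n, p = i + 1 := fun p hp => by
    rw [mem_Icc] at hp
    exact ⟨⟨p - 1, by lia⟩, by simp; lia⟩
  refine ⟨f, ?_, ?_, ?_⟩
  · intro p hp q hq hpq
    obtain ⟨i, rfl⟩ := hval' p hp
    obtain ⟨j, rfl⟩ := hval' q hq
    rw [hval, hval, OrderEmbedding.lt_iff_lt]
    simpa using hpq
  · intro p hp
    obtain ⟨i, rfl⟩ := hval' p hp
    rw [hval]
    exact orderEmbOfFin_mem _ _ _
  · intro x hx
    have : x ∈ Set.range (s.orderEmbOfFin hs) := by rwa [range_orderEmbOfFin]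
    obtain ⟨i, rfl⟩ := this
    exact ⟨i + 1, mem_Icc.2 (by lia), hval i⟩

lemma matchingCode_injOn {n S k : ℕ} (hS : 0 < S) (hn : n + 1 = S + 2 * k) :
    Set.InjOn (matchingCode : SetPartition n → _) (R n k) := by
  intro π hπ π' hπ' e
  have h := eqOn_of_strictMonoOn
    (card_keys hS hn (matchingCode_mem_codes hn hπ.1 hπ.2.1)) (strictMonoOn_nameOf hπ)
    (strictMonoOn_nameOf hπ') (fun p hp => nameOf_mem_keys hn hπ hp)
    (fun p hp => e ▸ nameOf_mem_keys hn hπ' hp)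
  exact (isLabelling_blockKey_nameOf hπ).unique (isLabelling_blockKey_nameOf hπ')
    fun p hp q hq => by rw [h p hp, h q hq]

/-! ### The matching with a given code -/

/-- `φ` enumerates in increasing order the names of the elements of a matching with code `C`, and
`π` is the partition of `[n]` obtained by joining the two names of each arc. -/
structure IsNaming {n : ℕ} (S k : ℕ) (C : ℕ → Multiset ℕ) (π : SetPartition n) (φ : ℕ → Key) :
    Prop where
  mem_codes : C ∈ Codes S k
  strictMono : StrictMonoOn φ (Icc 1 n : Finset ℕ)
  mem : ∀ p ∈ Icc 1 n, φ p ∈ keys S C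
  surj : ∀ x ∈ keys S C, ∃ p ∈ Icc 1 n, φ p = x
  labelling : IsLabelling π fun p => blockKey (φ p)

namespace IsNaming

variable {n S k : ℕ} {C : ℕ → Multiset ℕ} {π : SetPartition n} {φ : ℕ → Key}

lemma le_of_lt_count (h : IsNaming S k C π φ) {i j t : ℕ} (ht : t < (C j).count i) :
    i ≤ j ∧ j < S := by
  refine ⟨h.mem_codes.1 j i (Multiset.count_pos.1 (by lia)), ?_⟩
  by_contra hj
  rw [h.mem_codes.2.1 j (by lia)] at ht
  simp at ht

lemma cases (h : IsNaming S k C π φ) {p : ℕ} (hp : p ∈ Icc 1 n) :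
    (∃ j, 0 < j ∧ j < S ∧ φ p = key j 0 0 0) ∨
      (∃ i j t, t < (C j).count i ∧ φ p = key i 1 j t) ∨
      ∃ i j t, t < (C j).count i ∧ φ p = key j 2 i t :=
  (mem_keys h.mem_codes).1 (h.mem p hp)

lemma lt_iff (h : IsNaming S k C π φ) {p q : ℕ} (hp : p ∈ Icc 1 n) (hq : q ∈ Icc 1 n) :
    φ p < φ q ↔ p < q :=
  h.strictMono.lt_iff_lt (mem_coe.2 hp) (mem_coe.2 hq)

lemma inj (h : IsNaming S k C π φ) {p q : ℕ} (hp : p ∈ Icc 1 n) (hq : q ∈ Icc 1 n)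
    (e : φ p = φ q) : p = q :=
  h.strictMono.injOn (mem_coe.2 hp) (mem_coe.2 hq) e

lemma mem_arcs_iff (h : IsNaming S k C π φ) {p q : ℕ} : (p, q) ∈ arcs π ↔ p ∈ Icc 1 n ∧
    q ∈ Icc 1 n ∧ ∃ i j t, t < (C j).count i ∧ φ p = key i 1 j t ∧ φ q = key j 2 i t := by
  rw [h.labelling.mem_arcs]
  constructor
  · rintro ⟨h1, h2, h3, h4, -⟩
    have hp : p ∈ Icc 1 n := mem_Icc.2 (by lia)
    have hq : q ∈ Icc 1 n := mem_Icc.2 (by lia)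
    refine ⟨hp, hq, ?_⟩
    have hne : φ p ≠ φ q := fun e => h3.ne (h.inj hp hq e)
    have hlt := (h.lt_iff hp hq).2 h3
    rcases h.cases hp with ⟨j, -, -, e⟩ | ⟨i, j, t, ht, e⟩ | ⟨i, j, t, ht, e⟩ <;>
    rcases h.cases hq with ⟨j', -, -, e'⟩ | ⟨i', j', t', ht', e'⟩ | ⟨i', j', t', ht', e'⟩ <;>
    rw [e, e'] at hlt hne h4 <;>
    simp only [blockKey_two, blockKey_of_ne _ _ _ (show 0 ≠ 2 by lia),
      blockKey_of_ne _ _ _ (show 1 ≠ 2 by lia), key_inj, key_lt_key] at hlt hne h4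
    · lia
    · lia
    · lia
    · lia
    · lia
    · obtain ⟨rfl, -, rfl, rfl⟩ := h4
      exact ⟨i, j, t, ht, e, e'⟩
    · lia
    · have := h.le_of_lt_count ht
      lia
    · lia
  · rintro ⟨hp, hq, i, j, t, ht, e, e'⟩
    have hij := h.le_of_lt_count ht
    have hpq : p < q := by
      rw [← h.lt_iff hp hq, e, e', key_lt_key]
      lia
    refine ⟨(mem_Icc.1 hp).1, (mem_Icc.1 hq).2, hpq, ?_, fun l hl hl' el => ?_⟩
    · simp only [e, e']
      rfl
    · have hln : l ∈ Icc 1 n := by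
        rw [mem_Icc] at hp hq ⊢
        lia
      simp only [e, blockKey_of_ne _ _ _ (show 1 ≠ 2 by lia)] at el
      rcases h.cases hln with ⟨j', -, -, e2⟩ | ⟨i', j', t', ht', e2⟩ | ⟨i', j', t', ht', e2⟩ <;>
      rw [e2] at el <;>
      simp only [blockKey_two, blockKey_of_ne _ _ _ (show 0 ≠ 2 by lia),
        blockKey_of_ne _ _ _ (show 1 ≠ 2 by lia), key_inj] at el
      · lia
      · obtain ⟨rfl, -, rfl, rfl⟩ := el
        exact hl.ne (h.inj hp hln (e.trans e2.symm))
      · obtain ⟨rfl, -, rfl, rfl⟩ := el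
        exact hl'.ne (h.inj hln hq (e2.trans e'.symm))

lemma exists_arc (h : IsNaming S k C π φ) {i j t : ℕ} (ht : t < (C j).count i) :
    ∃ p q, (p, q) ∈ arcs π ∧ φ p = key i 1 j t ∧ φ q = key j 2 i t := by
  obtain ⟨p, hp, e⟩ := h.surj (key i 1 j t)
    ((mem_keys h.mem_codes).2 (Or.inr (Or.inl ⟨i, j, t, ht, rfl⟩)))
  obtain ⟨q, hq, e'⟩ := h.surj (key j 2 i t)
    ((mem_keys h.mem_codes).2 (Or.inr (Or.inr ⟨i, j, t, ht, rfl⟩)))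
  exact ⟨p, q, h.mem_arcs_iff.2 ⟨hp, hq, i, j, t, ht, e, e'⟩, e, e'⟩

lemma mem_singletons_iff (h : IsNaming S k C π φ) {p : ℕ} (hp : p ∈ Icc 1 n) :
    p ∈ singletons π ↔ ∃ j, 0 < j ∧ j < S ∧ φ p = key j 0 0 0 := by
  rw [singletons, mem_sdiff, and_iff_right hp, mem_union, mem_openers, mem_closers]
  constructor
  · intro hn
    rcases h.cases hp with h1 | ⟨i, j, t, ht, e⟩ | ⟨i, j, t, ht, e⟩
    · exact h1
    · obtain ⟨p', q, ha, e', -⟩ := h.exists_arc ht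
      obtain rfl := h.inj hp (h.mem_arcs_iff.1 ha).1 (e.trans e'.symm)
      exact absurd (Or.inl ⟨q, ha⟩) hn
    · obtain ⟨q, p', ha, -, e'⟩ := h.exists_arc ht
      obtain rfl := h.inj hp (h.mem_arcs_iff.1 ha).2.1 (e.trans e'.symm)
      exact absurd (Or.inr ⟨q, ha⟩) hn
  · rintro ⟨j, -, -, e⟩ (⟨q, hq⟩ | ⟨q, hq⟩)
    · obtain ⟨-, -, i', j', t, -, e', -⟩ := h.mem_arcs_iff.1 hq
      rw [e, key_inj] at e'
      lia
    · obtain ⟨-, -, i', j', t, -, -, e'⟩ := h.mem_arcs_iff.1 hq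
      rw [e, key_inj] at e'
      lia

lemma isPartialMatching (h : IsNaming S k C π φ) : IsPartialMatching π := by
  rw [isPartialMatching_iff, disjoint_left]
  intro p hp hp'
  obtain ⟨q, hq⟩ := mem_openers.1 hp
  obtain ⟨r, hr⟩ := mem_closers.1 hp'
  obtain ⟨-, -, i, j, t, -, e, -⟩ := h.mem_arcs_iff.1 hq
  obtain ⟨-, -, i', j', t', -, -, e'⟩ := h.mem_arcs_iff.1 hr
  rw [e, key_inj] at e'
  lia

/-- The first component of the name of `p` is the segment of `p`. -/
lemma segment_eq (h : IsNaming S k C π φ) {p a b c d : ℕ} (hp : p ∈ Icc 1 n)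
    (e : φ p = key a b c d) : segment π p = a := by
  have ha : a < S ∨ a = 0 := by
    rcases h.cases hp with ⟨j, -, hj, e'⟩ | ⟨i, j, t, ht, e'⟩ | ⟨i, j, t, ht, e'⟩ <;>
    rw [e, key_inj] at e'
    · lia
    · have := h.le_of_lt_count ht
      lia
    · have := h.le_of_lt_count ht
      lia
  have himg : ((singletons π).filter (· ≤ p)).image φ = (Ioc 0 a).image fun j => key j 0 0 0 := by
    ext x
    simp only [mem_image, mem_filter, mem_Ioc]
    constructor
    · rintro ⟨q, ⟨hq, hqp⟩, rfl⟩
      have hq' : q ∈ Icc 1 n := (mem_sdiff.1 hq).1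
      obtain ⟨j, hj, -, ej⟩ := (h.mem_singletons_iff hq').1 hq
      refine ⟨j, ⟨hj, ?_⟩, ej.symm⟩
      have := not_lt.2 hqp
      rw [← h.lt_iff hp hq', e, ej, key_lt_key] at this
      lia
    · rintro ⟨j, ⟨hj, hja⟩, rfl⟩
      obtain ⟨q, hq, ej⟩ := h.surj (key j 0 0 0)
        ((mem_keys h.mem_codes).2 (Or.inl ⟨j, hj, by lia, rfl⟩))
      refine ⟨q, ⟨(h.mem_singletons_iff hq).2 ⟨j, hj, by lia, ej⟩, ?_⟩, ej⟩
      by_contra hlt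
      have := (h.lt_iff hp hq).2 (by lia)
      rw [e, ej, key_lt_key] at this
      lia
  have h1 := congrArg card himg
  rw [card_image_of_injOn, card_image_of_injective, Nat.card_Ioc] at h1
  · exact h1
  · exact fun j j' hjj => (key_inj.1 hjj).1
  · exact h.strictMono.injOn.mono fun q hq =>
      mem_coe.2 (mem_sdiff.1 (mem_filter.1 (mem_coe.1 hq)).1).1

lemma matchingCode_eq (h : IsNaming S k C π φ) : matchingCode π = C := by
  funext j
  refine Multiset.ext.2 fun i => ?_
  rw [count_matchingCode]
  -- The arcs from segment `i` to segment `j` are numbered by the last component of the name.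
  have hname : ∀ e ∈ (arcs π).filter fun e => segment π e.1 = i ∧ segment π e.2 = j,
      ∃ t < (C j).count i, e.1 ∈ Icc 1 n ∧ e.2 ∈ Icc 1 n ∧ φ e.1 = key i 1 j t ∧
        φ e.2 = key j 2 i t := by
    rintro ⟨p, q⟩ he
    obtain ⟨ha, h1, h2⟩ := mem_filter.1 he
    obtain ⟨hp, hq, i', j', t, ht, e, e'⟩ := h.mem_arcs_iff.1 ha
    simp only at h1 h2
    rw [h.segment_eq hp e] at h1
    rw [h.segment_eq hq e'] at h2
    subst h1 h2
    exact ⟨t, ht, hp, hq, e, e'⟩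
  have hlast : ∀ a b c d, (ofLex (ofLex (ofLex (key a b c d)).2).2).2 = d := fun _ _ _ _ => rfl
  refine (card_nbij (t := range ((C j).count i))
    (fun e => (ofLex (ofLex (ofLex (φ e.1)).2).2).2) ?_ ?_ ?_).trans (card_range _)
  · intro e he
    obtain ⟨t, ht, -, -, e1, -⟩ := hname e he
    simp only [e1, hlast]
    exact mem_coe.2 (mem_range.2 ht)
  · intro e he f hf hef
    obtain ⟨t, -, hp, hq, e1, e2⟩ := hname e he
    obtain ⟨t', -, hp', hq', f1, f2⟩ := hname f hf
    simp only [e1, f1, hlast] at hef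
    subst hef
    exact Prod.ext (h.inj hp hp' (e1.trans f1.symm)) (h.inj hq hq' (e2.trans f2.symm))
  · intro t ht
    obtain ⟨p, q, ha, e, e'⟩ := h.exists_arc (mem_range.1 (mem_coe.1 ht))
    have hb := h.mem_arcs_iff.1 ha
    refine ⟨(p, q), mem_coe.2 (mem_filter.2
      ⟨ha, h.segment_eq hb.1 e, h.segment_eq hb.2.1 e'⟩), ?_⟩
    simp only [e, hlast]

/-- A singleton block separates consecutive segments, so only a singleton block can follow an
element of an earlier segment. -/
lemma fst_eq_of_succ (h : IsNaming S k C π φ) {p a b c d a' b' c' d' : ℕ} (hp : p ∈ Icc 1 n)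
    (hp' : p + 1 ∈ Icc 1 n) (e : φ p = key a b c d) (e' : φ (p + 1) = key a' b' c' d')
    (hb : b' ≠ 0) : a = a' := by
  have h1 := segment_succ π p
  rw [if_neg, h.segment_eq hp e, h.segment_eq hp' e', add_zero] at h1
  · exact h1.symm
  · rw [h.mem_singletons_iff hp']
    rintro ⟨j, -, -, e2⟩
    rw [e', key_inj] at e2
    exact hb e2.2.1

lemma mem_R (h : IsNaming S k C π φ) : π ∈ R n k := by
  have hlt : ∀ e ∈ arcs π, segment π e.2 < S := by
    rintro ⟨p, q⟩ he
    obtain ⟨hp, hq, i, j, t, ht, e, e'⟩ := h.mem_arcs_iff.1 he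
    rw [h.segment_eq hq e']
    exact (h.le_of_lt_count ht).2
  refine ⟨h.isPartialMatching, ?_, ?_, ?_, ?_⟩
  · rw [← sum_card_matchingCode hlt, h.matchingCode_eq, h.mem_codes.2.2]
  · rintro ⟨p, q⟩ he ⟨q', r⟩ hf ⟨-, h1⟩
    simp only at h1
    subst h1
    obtain ⟨-, hq, i, j, t, -, -, e⟩ := h.mem_arcs_iff.1 he
    obtain ⟨hq', -, i', j', t', -, e', -⟩ := h.mem_arcs_iff.1 hf
    have h2 := h.fst_eq_of_succ hq hq' e e' (by lia)
    have h3 := (h.lt_iff hq hq').2 (by lia)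
    rw [e, e', key_lt_key] at h3
    lia
  · rintro ⟨p, q⟩ he ⟨p', q'⟩ hf ⟨⟨-, -, h0⟩, h1⟩
    simp only at h1 h0
    subst h1
    obtain ⟨hp, hq, i, j, t, -, e, e2⟩ := h.mem_arcs_iff.1 he
    obtain ⟨hp', hq', i', j', t', -, e', e2'⟩ := h.mem_arcs_iff.1 hf
    have h2 := h.fst_eq_of_succ hp hp' e e' (by lia)
    have h3 := (h.lt_iff hp hp').2 (by lia)
    rw [← h.lt_iff hq' hq, e2, e2', key_lt_key] at h0
    rw [e, e', key_lt_key] at h3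
    lia
  · rintro ⟨p', q'⟩ hf ⟨p, q⟩ he ⟨⟨h0, -, -⟩, h1⟩
    simp only at h1 h0
    subst h1
    obtain ⟨hp, hq, i, j, t, -, e2, e⟩ := h.mem_arcs_iff.1 he
    obtain ⟨hp', hq', i', j', t', -, e2', e'⟩ := h.mem_arcs_iff.1 hf
    have h2 := h.fst_eq_of_succ hq hq' e e' (by lia)
    have h3 := (h.lt_iff hq hq').2 (by lia)
    rw [← h.lt_iff hp' hp, e2, e2', key_lt_key] at h0
    rw [e, e', key_lt_key] at h3
    lia

end IsNaming

lemma matchingCode_bijOn {n S k : ℕ} (hS : 0 < S) (hn : n + 1 = S + 2 * k) :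
    Set.BijOn (matchingCode : SetPartition n → _) (R n k) (Codes S k) := by
  refine ⟨fun π hπ => matchingCode_mem_codes hn hπ.1 hπ.2.1, matchingCode_injOn hS hn,
    fun C hC => ?_⟩
  obtain ⟨φ, h1, h2, h3⟩ := exists_strictMonoOn (card_keys hS hn hC)
  obtain ⟨π, hπ⟩ := exists_partition_isLabelling n fun p => blockKey (φ p)
  have h : IsNaming S k C π φ := ⟨hC, h1, h2, h3, hπ⟩
  exact ⟨π, h.mem_R, h.matchingCode_eq⟩

/-! ### Left crossings -/

/-- In `R n k`, two arcs with adjacent left endpoints always cross. -/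
lemma leftCrossingCount_eq {n k : ℕ} {π : SetPartition n} (hπ : π ∈ R n k) :
    leftCrossingCount π = ((openers π).filter fun p => p - 1 ∈ openers π).card := by
  unfold leftCrossingCount
  refine card_nbij (fun x => x.2.1) ?_ ?_ ?_
  · rintro ⟨⟨p, q⟩, p', q'⟩ hx
    obtain ⟨hx, -, h1⟩ := mem_filter.1 hx
    rw [mem_product] at hx
    simp only at h1
    subst h1
    simp only [mem_coe, mem_filter, Nat.add_sub_cancel, mem_openers]
    exact ⟨⟨q', hx.2⟩, q, hx.1⟩
  · rintro ⟨⟨p, q⟩, p', q'⟩ hx ⟨⟨r, s⟩, r', s'⟩ hy hxy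
    obtain ⟨hx, -, h1⟩ := mem_filter.1 (mem_coe.1 hx)
    obtain ⟨hy, -, h2⟩ := mem_filter.1 (mem_coe.1 hy)
    rw [mem_product] at hx hy
    simp only at h1 h2 hxy hx hy
    subst hxy
    obtain rfl : p = r := by lia
    rw [arc_right_unique hx.1 hy.1, arc_right_unique hx.2 hy.2]
  · intro p hp
    obtain ⟨hp, hp'⟩ := mem_filter.1 (mem_coe.1 hp)
    have hpos := (mem_Icc.1 (openers_subset π hp)).1
    obtain ⟨r, rfl⟩ : ∃ r, p = r + 1 := ⟨p - 1, by lia⟩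
    rw [Nat.add_sub_cancel] at hp'
    obtain ⟨q', hq'⟩ := mem_openers.1 hp
    obtain ⟨q, hq⟩ := mem_openers.1 hp'
    have h1 : r + 1 ≠ q := by
      rintro rfl
      exact disjoint_left.1 (isPartialMatching_iff.1 hπ.1) hp (mem_closers.2 ⟨r, hq⟩)
    have h2 := (arc_bounds hq).2.1
    refine ⟨((r, q), (r + 1, q')), mem_coe.2 (mem_filter.2 ⟨mem_product.2 ⟨hq, hq'⟩, ?_, rfl⟩), rfl⟩
    exact ⟨by simp, by simp; lia, R.lt_of_openers hπ hq hq'⟩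

/-- Each nonzero row of the code comes from one maximal run of consecutive left endpoints. -/
lemma card_rows_matchingCode {n S k : ℕ} (hn : n + 1 = S + 2 * k) {π : SetPartition n}
    (hπ : π ∈ R n k) : (rows S (matchingCode π)).card =
      ((openers π).filter fun p => p - 1 ∉ openers π).card := by
  have hC := matchingCode_mem_codes hn hπ.1 hπ.2.1
  symm
  refine card_nbij (segment π) ?_ ?_ ?_
  · intro p hp
    obtain ⟨q, hq⟩ := mem_openers.1 (mem_filter.1 (mem_coe.1 hp)).1
    have hmem : segment π p ∈ matchingCode π (segment π q) := mem_matchingCode.2 ⟨_, hq, rfl, rfl⟩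
    refine mem_coe.2 (mem_rows.2 ⟨_, ?_, hmem⟩)
    by_contra hlt
    rw [hC.2.1 _ (by lia)] at hmem
    simp at hmem
  · -- The element before the start of a run of left endpoints is a singleton block.
    have key : ∀ p ∈ (openers π).filter fun p => p - 1 ∉ openers π, ∀ q < p, q ∈ openers π →
        segment π q ≠ segment π p := by
      intro p hp q hqp hq
      obtain ⟨hp, hp'⟩ := mem_filter.1 hp
      have hpn := mem_Icc.1 (openers_subset π hp)
      have hqn := mem_Icc.1 (openers_subset π hq)
      obtain ⟨r, rfl⟩ : ∃ r, p = r + 1 := ⟨p - 1, by lia⟩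
      rw [Nat.add_sub_cancel] at hp'
      obtain ⟨s, hs⟩ := mem_openers.1 hp
      have hqr : q < r := lt_of_le_of_ne (by lia) fun e => hp' (e ▸ hq)
      rcases trichotomy π (mem_Icc.2 (by lia) : r ∈ Icc 1 n) with h | ⟨s', h⟩ | ⟨s', h⟩
      · obtain ⟨t, rfl⟩ : ∃ t, r = t + 1 := ⟨r - 1, by lia⟩
        have h1 := segment_succ π t
        rw [if_pos h] at h1
        have h2 := segment_mono π (show q ≤ t by lia)
        have h3 := segment_mono π (show t + 1 ≤ t + 1 + 1 by lia)
        lia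
      · exact absurd (mem_openers.2 ⟨s', h⟩) hp'
      · exact absurd hs (R.not_closer_opener hπ h)
    intro p hp q hq e
    rcases lt_trichotomy p q with hl | hl | hl
    · exact absurd e (key q hq p hl (mem_filter.1 (mem_coe.1 hp)).1)
    · exact hl
    · exact absurd e.symm (key p hp q hl (mem_filter.1 (mem_coe.1 hq)).1)
  · intro i hi
    obtain ⟨j, -, hij⟩ := mem_rows.1 (mem_coe.1 hi)
    obtain ⟨⟨p, q⟩, he, -, rfl⟩ := mem_matchingCode.1 hij
    have hp := mem_openers.2 ⟨q, he⟩
    clear he hi hij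
    induction p with
    | zero =>
      have := (mem_Icc.1 (openers_subset π hp)).1
      lia
    | succ p ih =>
      by_cases hp' : p ∈ openers π
      · obtain ⟨r, hr, hr'⟩ := ih hp'
        obtain ⟨s, hs⟩ := mem_openers.1 hp
        refine ⟨r, hr, hr'.trans ?_⟩
        rw [segment_succ, if_neg (not_mem_singletons_left hs), add_zero]
      · exact ⟨p + 1, mem_coe.2 (mem_filter.2 ⟨hp, by simpa using hp'⟩), rfl⟩

theorem exists_equiv_R_codes {n S k : ℕ} (hS : 0 < S) (hn : n + 1 = S + 2 * k) :
    ∃ e : R n k ≃ Codes S k,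
      ∀ π : R n k, leftCrossingCount π.1 + (rows S (e π).1).card = k := by
  refine ⟨(matchingCode_bijOn hS hn).equiv, fun π => ?_⟩
  change leftCrossingCount π.1 + (rows S (matchingCode π.1)).card = k
  rw [leftCrossingCount_eq π.2, card_rows_matchingCode hn π.2,
    card_filter_add_card_filter_not, card_openers, π.2.2.1]

lemma two_mul_le_of_mem_R {n k : ℕ} {π : SetPartition n} (hπ : π ∈ R n k) : 2 * k ≤ n := by
  have := card_singletons hπ.1
  have := hπ.2.1
  lia

/-- The element `1` is not a right endpoint, so a partition of a nonempty `[m]` has fewer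
than `m` arcs. -/
lemma card_arcs_le {m : ℕ} (π : SetPartition m) : (arcs π).card ≤ m - 1 := by
  rw [← card_closers]
  have : closers π ⊆ Icc 2 m := by
    intro q hq
    obtain ⟨p, hp⟩ := mem_closers.1 hq
    have := arc_bounds hp
    exact mem_Icc.2 (by lia)
  have := card_le_card this
  rw [Nat.card_Icc] at this
  lia

end NeighborPatterns

theorem theorem5p1 (n k : ℕ) :
    ∃ γ : NeighborPatterns.R n k ≃ NeighborPatterns.T (n + 1 - k) k,
      ∀ M : NeighborPatterns.R n k,
        NeighborPatterns.transientCount (γ M).1 = NeighborPatterns.leftCrossingCount M.1 := by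
  rcases le_or_gt (2 * k) n with h | h
  · obtain ⟨S, hS⟩ : ∃ S, n + 1 = S + 2 * k := ⟨n + 1 - 2 * k, by lia⟩
    have hm : n + 1 - k = S + k := by lia
    rw [hm]
    obtain ⟨e₁, h₁⟩ := NeighborPatterns.exists_equiv_R_codes (by lia) hS
    obtain ⟨e₂, h₂⟩ := NeighborPatterns.exists_equiv_T_codes S k
    refine ⟨e₁.trans e₂.symm, fun M => ?_⟩
    have h3 := h₁ M
    have h4 := h₂ (e₂.symm (e₁ M))
    rw [Equiv.apply_symm_apply] at h4
    rw [Equiv.trans_apply]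
    lia
  · -- With too many arcs both sides are empty.
    have h1 : IsEmpty (NeighborPatterns.R n k) :=
      ⟨fun M => by have := NeighborPatterns.two_mul_le_of_mem_R M.2; lia⟩
    have h2 : IsEmpty (NeighborPatterns.T (n + 1 - k) k) :=
      ⟨fun M => by
        have h3 := NeighborPatterns.card_arcs_le M.1
        rw [M.2.1] at h3
        lia⟩
    exact ⟨Equiv.equivOfIsEmpty _ _, fun M => h1.elim M⟩
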